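/- Let $s=\sigma+it$, let $\zeta$ be the Riemann zeta function and let $L(s)=L(s,\chi_4)=\sum_{n\ge 0}(-1)^n(2n+1)^{-s}$ be the Dirichlet beta function (continued analytically to $\mathbb C$). Put $h(s)=(1-2^s)(1-2^{1-s})$ and let $$Э(s)=\frac{(1-2^{s})(1-2^{1-s})\,\Gamma(s)\,\zeta(s)\,L(s)}{\pi^{s}},$$ where at the isolated points $s=1,0,-1,-2,\dots$ the value is defined as the limit of this expression. Then $Э$ is an entire function, and: (i) All zeros of $Э$ lie in the strip $0\le\sigma\le 1$, and the set of zeros is symmetric about the line $t=0$ (under $s\mapsto\bar s$) and about the line $\sigma=\tfrac12$ (under $s\mapsto 1-\bar s$). (ii) The zeros of $Э$ are exactly the imaginary (that is, non-real) zeros of $h(s)=(1-2^s)(1-2^{1-s})$ together with the nontrivial zeros of $\zeta$ (the zeros other than $-2,-4,-6,\dots$) and the nontrivial zeros of $L$ (the zeros other than $-1,-3,-5,\dots$). $Э$ has no zeros on the real axis. (iii) For every real $T$ the rectangle $0\le\sigma\le1$, $0\le t\le T$ contains only finitely many zeros of $Э$, and their number $N(T)$, counted with multiplicity, satisfies $$N(T)=\frac{T}{\pi}\log\frac{2T}{\pi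 e}+O(\log T)\qquad (T\to\infty).$$ -/

import Mathlib

open Filter Topology Asymptotics

noncomputable section

namespace EReversed

/-- The nontrivial Dirichlet character modulo 4, with complex values. -/
def chi4 : DirichletCharacter ℂ 4 := ZMod.χ₄.ringHomComp (Int.castRingHom ℂ)

/-- The Dirichlet beta function `L(s) = L(s, χ₄) = ∑ (-1)^n / (2n+1)^s`,
continued to the whole complex plane. -/
def dirichletL (s : ℂ) : ℂ := chi4.LFunction s

/-- The factor `h(s) = (1 - 2^s)(1 - 2^(1-s))`. -/
def hFactor (s : ℂ) : ℂ := (1 - (2 : ℂ) ^ s) * (1 - (2 : ℂ) ^ (1 - s))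

/-- The expression `(1 - 2^s)(1 - 2^(1-s)) Γ(s) ζ(s) L(s) / π^s`. It is meaningful away from the
poles of `Γ` and of `ζ`, that is, for `s ∉ {1, 0, -1, -2, …}`. -/
def formula (s : ℂ) : ℂ :=
  hFactor s * Complex.Gamma s * riemannZeta s * dirichletL s / (Real.pi : ℂ) ^ s

/-- The function `Э`: the value at `s` is the limit of the defining expression at `w → s`, `w ≠ s`.
Where the expression is regular this is its value, and at the isolated points `1, 0, -1, -2, …` the
singularity is removed. -/
def E (s : ℂ) : ℂ := limUnder (𝓝[≠] s) formula

/-- `s` is a nontrivial zero of the Riemann zeta function: a zero other than `-2, -4, -6, …`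
(the pole `s = 1` is excluded, where Mathlib assigns a conventional value). -/
def IsNontrivialZetaZero (s : ℂ) : Prop :=
  s ≠ 1 ∧ riemannZeta s = 0 ∧ ¬ ∃ n : ℕ, s = -2 * ((n : ℂ) + 1)

/-- `s` is a nontrivial zero of the Dirichlet beta function: a zero other than
`-1, -3, -5, …`. -/
def IsNontrivialLZero (s : ℂ) : Prop :=
  dirichletL s = 0 ∧ ¬ ∃ n : ℕ, s = -(2 * (n : ℂ) + 1)

/-- The zeros of `Э` in the rectangle `0 ≤ σ ≤ 1`, `0 ≤ t ≤ T`. -/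
def zerosUpTo (T : ℝ) : Set ℂ :=
  {s : ℂ | E s = 0 ∧ 0 ≤ s.re ∧ s.re ≤ 1 ∧ 0 ≤ s.im ∧ s.im ≤ T}

/-- `N(T)`: the number of zeros of `Э` in the rectangle `0 ≤ σ ≤ 1`, `0 ≤ t ≤ T`, counted with
multiplicity. -/
def zeroCount (T : ℝ) : ℕ := ∑ᶠ s ∈ zerosUpTo T, analyticOrderNatAt E s

end EReversed

end

/-! Write Λ for the completed zeta function. The factor h vanishes at 0 and 1, so it cancels the
poles of Λ. By the duplication formula, Э(s) = (2^s/2) · h(s)Λ(s) · Λ(s, χ₄) away from isolated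
points, and the right side (`entireE`) extends to an entire function. Here h(1-s) = h(s), the root
number of χ₄ is 1, and 2^s absorbs the conductor factor 4^(s-1/2), so Э(1-s) = Э(s).

For σ > 0, `E_eq_mul` gives Э(s) = -(2/π)^s Γ(s) · (1-2^(-s)) η(s) L(s) with η(s) = (1-2^(1-s))
ζ(s). Both η and L are alternating series that converge for σ > 0 and are positive on the positive
reals, so Э has no positive real zero. Non-vanishing of ζ and L for σ > 1 excludes zeros there. The
functional equation carries both facts to the left, and (ii) is read off from the factors.

For (iii), Э is real on the real axis and on the critical line, and its zeros are symmetric about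
the latter. Hence the argument of Э changes by π N(T) along 1/2 → 2 → 2+iT → 1/2+iT
(`exists_log_E`). The bottom side contributes nothing. The Gamma factor contributes its argument at
1/2+iT (`abs_im_logGamma_sub_le`), which is the main term. The Dirichlet series factor contributes
O(1) on σ = 2 and O(log T) on the top side; the latter is Backlund's argument, combining polynomial
growth, a Jensen-type zero count and the Borel–Carathéodory theorem (`exists_log_on_radius`).

No contour integral is used. Continuous logarithms are built explicitly and compared along each side
by `im_eq_of_exp_im_eq_zero`. -/

namespace EReversed

/-! ### Alternating Dirichlet series -/

/-- The series `∑ ((m k + a)^(-s) - (m k + b)^(-s))`. -/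
noncomputable def pairedSeries (m a b : ℕ) (s : ℂ) : ℂ :=
  ∑' k : ℕ, (((m * k + a : ℕ) : ℂ) ^ (-s) - ((m * k + b : ℕ) : ℂ) ^ (-s))

lemma norm_cpow_neg_sub_cpow_neg_le {x y : ℝ} (hx : 0 < x) (hxy : x ≤ y) {s : ℂ}
    (hs : 0 ≤ s.re) :
    ‖(x : ℂ) ^ (-s) - (y : ℂ) ^ (-s)‖ ≤ ‖s‖ * x ^ (-s.re - 1) * (y - x) := by
  have hd : ∀ t ∈ Set.Icc x y, HasDerivWithinAt (fun t : ℝ => (t : ℂ) ^ (-s))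
      (-s * (t : ℂ) ^ (-s - 1)) (Set.Icc x y) t := by
    intro t ht
    have ht0 : 0 < t := hx.trans_le ht.1
    have h1 : HasDerivAt (fun z : ℂ => z ^ (-s)) (-s * (t : ℂ) ^ (-s - 1) * 1) (t : ℂ) :=
      (hasDerivAt_id _).cpow_const (Or.inl (by simpa using ht0))
    simpa using h1.comp_ofReal.hasDerivWithinAt
  have hb : ∀ t ∈ Set.Icc x y, ‖-s * (t : ℂ) ^ (-s - 1)‖ ≤ ‖s‖ * x ^ (-s.re - 1) := by
    intro t ht
    have ht0 : 0 < t := hx.trans_le ht.1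
    rw [norm_mul, norm_neg, Complex.norm_cpow_eq_rpow_re_of_pos ht0]
    gcongr
    simpa using Real.rpow_le_rpow_of_nonpos hx ht.1 (by linarith : -s.re - 1 ≤ 0)
  have := (convex_Icc x y).norm_image_sub_le_of_norm_hasDerivWithin_le hd hb
    (Set.left_mem_Icc.2 hxy) (Set.right_mem_Icc.2 hxy)
  rwa [Real.norm_eq_abs, abs_of_nonneg (by linarith), norm_sub_rev] at this

variable {m a b : ℕ}

/-- Pairing gains a factor 1/k by the mean value inequality, which moves convergence from `Re s > 1`
to `Re s > 0`, locally uniformly. -/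
lemma norm_pairedSeries_term_le (ha : 1 ≤ a) (hab : a ≤ b) (hm : 1 ≤ m) {σ : ℝ} (hσ : 0 < σ)
    {s : ℂ} (hs : σ ≤ s.re) (k : ℕ) :
    ‖((m * k + a : ℕ) : ℂ) ^ (-s) - ((m * k + b : ℕ) : ℂ) ^ (-s)‖ ≤
      ‖s‖ * b * ((k + 1 : ℕ) : ℝ) ^ (-(1 + σ)) := by
  have hx : (0 : ℝ) < ((m * k + a : ℕ) : ℝ) := by positivity
  have h1 : ((k + 1 : ℕ) : ℝ) ≤ ((m * k + a : ℕ) : ℝ) := by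
    exact_mod_cast add_le_add (Nat.le_mul_of_pos_left k hm) ha
  have h := norm_cpow_neg_sub_cpow_neg_le hx
    (by exact_mod_cast (by lia) : ((m * k + a : ℕ) : ℝ) ≤ ((m * k + b : ℕ) : ℝ))
    (hσ.le.trans hs)
  rw [Complex.ofReal_natCast, Complex.ofReal_natCast] at h
  refine h.trans ?_
  rw [mul_assoc, mul_assoc]
  gcongr ?_ * ?_
  rw [mul_comm]
  have h2 : ((m * k + b : ℕ) : ℝ) - ((m * k + a : ℕ) : ℝ) ≤ b := by
    push_cast; linarith [(Nat.cast_nonneg a : (0 : ℝ) ≤ a)]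
  have hk : (1 : ℝ) ≤ ((k + 1 : ℕ) : ℝ) := by simp
  have h3 : ((m * k + a : ℕ) : ℝ) ^ (-s.re - 1) ≤ ((k + 1 : ℕ) : ℝ) ^ (-(1 + σ)) := by
    calc ((m * k + a : ℕ) : ℝ) ^ (-s.re - 1) ≤ ((k + 1 : ℕ) : ℝ) ^ (-s.re - 1) :=
          Real.rpow_le_rpow_of_nonpos (by positivity) h1 (by linarith)
      _ ≤ _ := Real.rpow_le_rpow_of_exponent_le hk (by linarith)
  gcongr

lemma summable_nat_succ_rpow {σ : ℝ} (hσ : 0 < σ) :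
    Summable fun k : ℕ => ((k + 1 : ℕ) : ℝ) ^ (-(1 + σ)) :=
  (summable_nat_add_iff 1).2 (Real.summable_nat_rpow.2 (by linarith))

lemma summable_pairedSeries (ha : 1 ≤ a) (hab : a ≤ b) (hm : 1 ≤ m) {s : ℂ} (hs : 0 < s.re) :
    Summable fun k : ℕ => (((m * k + a : ℕ) : ℂ) ^ (-s) - ((m * k + b : ℕ) : ℂ) ^ (-s)) :=
  .of_norm_bounded ((summable_nat_succ_rpow hs).mul_left _)
    (norm_pairedSeries_term_le ha hab hm hs le_rfl)

/-- This linear growth is what later makes the top side of the contour contribute only O(log T). -/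
lemma norm_pairedSeries_le (ha : 1 ≤ a) (hab : a ≤ b) (hm : 1 ≤ m) {σ : ℝ} (hσ : 0 < σ) :
    ∃ C : ℝ, ∀ s : ℂ, σ ≤ s.re → ‖pairedSeries m a b s‖ ≤ C * ‖s‖ := by
  refine ⟨b * ∑' k : ℕ, ((k + 1 : ℕ) : ℝ) ^ (-(1 + σ)), fun s hs => ?_⟩
  refine (tsum_of_norm_bounded ((summable_nat_succ_rpow hσ).hasSum.mul_left (‖s‖ * b))
    (norm_pairedSeries_term_le ha hab hm hσ hs)).trans (le_of_eq (by ring))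

lemma differentiableAt_pairedSeries (ha : 1 ≤ a) (hab : a ≤ b) (hm : 1 ≤ m) {s : ℂ}
    (hs : 0 < s.re) : DifferentiableAt ℂ (pairedSeries m a b) s := by
  set U : Set ℂ := {z | s.re / 2 < z.re} ∩ Metric.ball 0 (‖s‖ + 1) with hU
  have hUo : IsOpen U :=
    (isOpen_lt continuous_const Complex.continuous_re).inter Metric.isOpen_ball
  have hsU : s ∈ U := ⟨by simp only [Set.mem_ofPred_eq]; linarith, by simp⟩
  refine (Complex.differentiableOn_tsum_of_summable_norm
    (u := fun k : ℕ => (‖s‖ + 1) * b * ((k + 1 : ℕ) : ℝ) ^ (-(1 + s.re / 2)))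
    ((summable_nat_succ_rpow (by linarith)).mul_left _) (fun k => ?_) hUo
    (fun k w hw => ?_)).differentiableAt (hUo.mem_nhds hsU)
  · have h1 : ((m * k + a : ℕ) : ℂ) ≠ 0 := by
      exact_mod_cast (by lia : m * k + a ≠ 0)
    have h2 : ((m * k + b : ℕ) : ℂ) ≠ 0 := by
      exact_mod_cast (by lia : m * k + b ≠ 0)
    exact ((differentiable_id.neg.const_cpow (Or.inl h1)).sub
      (differentiable_id.neg.const_cpow (Or.inl h2))).differentiableOn
  · refine (norm_pairedSeries_term_le ha hab hm (by linarith) (le_of_lt hw.1) k).trans ?_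
    have := mem_ball_zero_iff.1 hw.2
    gcongr

lemma pairedSeries_conj {s : ℂ} :
    pairedSeries m a b ((starRingEnd ℂ) s) = (starRingEnd ℂ) (pairedSeries m a b s) := by
  have h : ∀ n : ℕ, (n : ℂ) ^ (-(starRingEnd ℂ) s) = (starRingEnd ℂ) ((n : ℂ) ^ (-s)) := by
    intro n
    rw [← map_neg, Complex.cpow_conj _ _ (by
      rw [Complex.natCast_arg]; exact Real.pi_pos.ne), Complex.conj_natCast]
  rw [pairedSeries, pairedSeries, Complex.conj_tsum]
  simp only [h, map_sub]

/-- Every paired term is strictly positive. This is the source of all non-vanishing on the real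
axis. -/
lemma pairedSeries_ofReal_ne_zero (ha : 1 ≤ a) (hab : a < b) (hm : 1 ≤ m) {x : ℝ} (hx : 0 < x) :
    pairedSeries m a b (x : ℂ) ≠ 0 := by
  have hterm : ∀ k : ℕ, (((m * k + a : ℕ) : ℂ) ^ (-(x : ℂ)) - ((m * k + b : ℕ) : ℂ) ^ (-(x : ℂ))) =
      ((((m * k + a : ℕ) : ℝ) ^ (-x) - ((m * k + b : ℕ) : ℝ) ^ (-x) : ℝ) : ℂ) := by
    intro k
    rw [Complex.ofReal_sub, Complex.ofReal_cpow (by positivity), Complex.ofReal_cpow (by positivity)]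
    simp
  have hpos : ∀ k : ℕ, 0 < ((m * k + a : ℕ) : ℝ) ^ (-x) - ((m * k + b : ℕ) : ℝ) ^ (-x) := by
    intro k
    rw [sub_pos]
    refine Real.rpow_lt_rpow_of_neg ?_ ?_ (by linarith)
    · exact_mod_cast (by lia : 0 < m * k + a)
    · exact_mod_cast (by lia : m * k + a < m * k + b)
  have hs := summable_pairedSeries (m := m) ha hab.le hm (s := (x : ℂ)) (by simpa using hx)
  simp only [hterm] at hs
  rw [pairedSeries, tsum_congr hterm, ← Complex.ofReal_tsum, Complex.ofReal_ne_zero]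
  exact ((Complex.summable_ofReal.1 hs).tsum_pos (fun k => (hpos k).le) 0 (hpos 0)).ne'

lemma isOpen_re_pos : IsOpen {s : ℂ | 0 < s.re} := isOpen_lt continuous_const Complex.continuous_re

lemma eqOn_re_pos {f g : ℂ → ℂ} (hf : DifferentiableOn ℂ f {s | 0 < s.re})
    (hg : DifferentiableOn ℂ g {s | 0 < s.re}) (h : ∀ s : ℂ, 1 < s.re → f s = g s) {s : ℂ}
    (hs : 0 < s.re) : f s = g s := by
  have h2 : (1 : ℝ) < (2 : ℂ).re := by norm_num
  refine (hf.analyticOnNhd isOpen_re_pos).eqOn_of_preconnected_of_eventuallyEq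
    (hg.analyticOnNhd isOpen_re_pos) (convex_halfSpace_re_gt 0).isPreconnected
    (z₀ := 2) (by norm_num) ?_ hs
  filter_upwards [(isOpen_lt continuous_const Complex.continuous_re).mem_nhds h2] with z hz
  exact h z hz

lemma summable_progression_cpow (hm : 1 ≤ m) {s : ℂ} (hs : 1 < s.re) (a : ℕ) :
    Summable fun k : ℕ => ((m * k + a : ℕ) : ℂ) ^ (-s) := by
  have h : Summable fun n : ℕ => (n : ℂ) ^ (-s) := by
    simpa [Complex.cpow_neg] using Complex.summable_one_div_nat_cpow.2 hs
  exact h.comp_injective (i := fun k => m * k + a) fun x y hxy => by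
    have := Nat.eq_of_mul_eq_mul_left (by lia : 0 < m) (by simpa using hxy : m * x = m * y)
    exact this


/-! ### The regularised product of `h` and the completed zeta function -/

/-- The entire function `(1 - 2^s) / s`. -/
noncomputable def oneSubTwoCpowDiv : ℂ → ℂ := dslope (fun s : ℂ => 1 - (2 : ℂ) ^ s) 0

lemma differentiable_two_cpow : Differentiable ℂ fun s : ℂ => (2 : ℂ) ^ s :=
  differentiable_id.const_cpow (Or.inl two_ne_zero)

lemma differentiable_oneSubTwoCpowDiv : Differentiable ℂ oneSubTwoCpowDiv :=
  differentiableOn_univ.1 ((Complex.differentiableOn_dslope Filter.univ_mem).2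
    (differentiable_two_cpow.const_sub 1).differentiableOn)

lemma mul_oneSubTwoCpowDiv (s : ℂ) : s * oneSubTwoCpowDiv s = 1 - (2 : ℂ) ^ s := by
  simpa [oneSubTwoCpowDiv] using sub_smul_dslope (fun s : ℂ => 1 - (2 : ℂ) ^ s) 0 s

/-- The entire function which is `h(s) Λ(s)` for `s ≠ 0, 1`. -/
noncomputable def hCompletedZeta (s : ℂ) : ℂ :=
  hFactor s * completedRiemannZeta₀ s - oneSubTwoCpowDiv s * (1 - (2 : ℂ) ^ (1 - s)) -
    (1 - (2 : ℂ) ^ s) * oneSubTwoCpowDiv (1 - s)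

lemma hFactor_one_sub (s : ℂ) : hFactor (1 - s) = hFactor s := by
  simp only [hFactor, sub_sub_cancel]; ring

lemma hCompletedZeta_one_sub (s : ℂ) : hCompletedZeta (1 - s) = hCompletedZeta s := by
  simp only [hCompletedZeta, hFactor_one_sub, completedRiemannZeta₀_one_sub, sub_sub_cancel]
  ring

lemma differentiable_two_cpow_one_sub : Differentiable ℂ fun s : ℂ => (2 : ℂ) ^ (1 - s) :=
  differentiable_two_cpow.comp (differentiable_id.const_sub 1)

lemma differentiable_hFactor : Differentiable ℂ hFactor :=
  (differentiable_two_cpow.const_sub 1).mul (differentiable_two_cpow_one_sub.const_sub 1)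

lemma differentiable_hCompletedZeta : Differentiable ℂ hCompletedZeta :=
  ((differentiable_hFactor.mul differentiable_completedZeta₀).sub
    (differentiable_oneSubTwoCpowDiv.mul (differentiable_two_cpow_one_sub.const_sub 1))).sub
    ((differentiable_two_cpow.const_sub 1).mul
      (differentiable_oneSubTwoCpowDiv.comp (differentiable_id.const_sub 1)))

lemma hCompletedZeta_eq {s : ℂ} (h0 : s ≠ 0) (h1 : s ≠ 1) :
    hCompletedZeta s = hFactor s * completedRiemannZeta s := by
  have h1' : 1 - s ≠ 0 := sub_ne_zero.2 h1.symm
  rw [hCompletedZeta, completedRiemannZeta_eq, hFactor, ← mul_oneSubTwoCpowDiv s,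
    ← mul_oneSubTwoCpowDiv (1 - s)]
  field_simp

lemma norm_two_cpow (s : ℂ) : ‖(2 : ℂ) ^ s‖ = (2 : ℝ) ^ s.re := by
  simpa using Complex.norm_cpow_eq_rpow_re_of_pos (x := 2) two_pos s

lemma re_eq_zero_of_two_cpow_eq_one {s : ℂ} (h : (2 : ℂ) ^ s = 1) : s.re = 0 := by
  have h2 := norm_two_cpow s
  rw [h, norm_one, eq_comm] at h2
  have := congrArg Real.log h2
  rw [Real.log_rpow two_pos, Real.log_one, mul_eq_zero] at this
  exact this.resolve_right (Real.log_pos one_lt_two).ne'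

lemma one_sub_two_cpow_ne_zero {s : ℂ} (hs : s.re ≠ 0) : 1 - (2 : ℂ) ^ s ≠ 0 := fun h =>
  hs (re_eq_zero_of_two_cpow_eq_one (sub_eq_zero.1 h).symm)

lemma natCast_succ_cpow_neg (k : ℕ) (s : ℂ) :
    1 / ((k : ℂ) + 1) ^ s = ((k + 1 : ℕ) : ℂ) ^ (-s) := by
  rw [Complex.cpow_neg, one_div]; push_cast; rfl

lemma pairedSeries_two_one_two_of_one_lt_re {s : ℂ} (hs : 1 < s.re) :
    pairedSeries 2 1 2 s = (1 - (2 : ℂ) ^ (1 - s)) * riemannZeta s := by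
  have hA := summable_progression_cpow one_le_two hs 1
  have hB := summable_progression_cpow one_le_two hs 2
  have hall : riemannZeta s = ∑' k : ℕ, ((k + 1 : ℕ) : ℂ) ^ (-s) := by
    rw [zeta_eq_tsum_one_div_nat_add_one_cpow hs]
    exact tsum_congr fun k => natCast_succ_cpow_neg k s
  have hB' : ∑' k : ℕ, ((2 * k + 2 : ℕ) : ℂ) ^ (-s) = (2 : ℂ) ^ (-s) * riemannZeta s := by
    rw [hall, ← tsum_mul_left]
    refine tsum_congr fun k => ?_
    rw [show 2 * k + 2 = 2 * (k + 1) by ring, Nat.cast_mul, Complex.natCast_mul_natCast_cpow]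
    simp
  have hsplit : riemannZeta s = ∑' k : ℕ, ((2 * k + 1 : ℕ) : ℂ) ^ (-s) +
      ∑' k : ℕ, ((2 * k + 2 : ℕ) : ℂ) ^ (-s) := by
    rw [hall, ← tsum_even_add_odd (f := fun k : ℕ => ((k + 1 : ℕ) : ℂ) ^ (-s)) hA hB]
  rw [pairedSeries, hA.tsum_sub hB, Complex.cpow_sub _ _ two_ne_zero, Complex.cpow_one]
  rw [hB'] at hsplit ⊢
  rw [← sub_eq_iff_eq_add] at hsplit
  rw [← hsplit, Complex.cpow_neg]
  ring

/-- After division by factors without zeros in `Re s > 0`, the identity theorem extends the equality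
from `Re s > 1`. It thus covers s = 1 as well, where the expression through ζ is singular. -/
lemma hCompletedZeta_eq_pairedSeries {s : ℂ} (hs : 0 < s.re) :
    hCompletedZeta s = (1 - (2 : ℂ) ^ s) * Complex.Gammaℝ s * pairedSeries 2 1 2 s := by
  have hd : Differentiable ℂ fun s : ℂ => (Complex.Gammaℝ s)⁻¹ :=
    Complex.differentiable_Gammaℝ_inv
  have key := eqOn_re_pos
    (f := fun s => hCompletedZeta s * (Complex.Gammaℝ s)⁻¹ / (1 - (2 : ℂ) ^ s))
    (g := pairedSeries 2 1 2) (fun z hz => ?_) (fun z hz => ?_) (fun z hz => ?_) hs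
  · rw [← key]
    have h1 := one_sub_two_cpow_ne_zero hs.ne'
    have h2 := Complex.Gammaℝ_ne_zero_of_re_pos hs
    field_simp
  · exact (((differentiable_hCompletedZeta z).mul (hd z)).div
      ((differentiable_two_cpow.const_sub 1) z)
      (one_sub_two_cpow_ne_zero (ne_of_gt hz))).differentiableWithinAt
  · exact (differentiableAt_pairedSeries le_rfl one_le_two one_le_two hz).differentiableWithinAt
  · have hz0 : z ≠ 0 := by rintro rfl; norm_num at hz
    have hz1 : z ≠ 1 := by rintro rfl; norm_num at hz
    have h1 := one_sub_two_cpow_ne_zero (s := z) (by linarith)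
    rw [pairedSeries_two_one_two_of_one_lt_re hz, hCompletedZeta_eq hz0 hz1,
      riemannZeta_def_of_ne_zero hz0, hFactor]
    field_simp

lemma pairedSeries_two_one_two {s : ℂ} (hs : 0 < s.re) (hs1 : s ≠ 1) :
    pairedSeries 2 1 2 s = (1 - (2 : ℂ) ^ (1 - s)) * riemannZeta s := by
  have hs0 : s ≠ 0 := by rintro rfl; simp at hs
  have h1 := one_sub_two_cpow_ne_zero hs.ne'
  have h2 := Complex.Gammaℝ_ne_zero_of_re_pos hs
  have h := hCompletedZeta_eq_pairedSeries hs
  rw [hCompletedZeta_eq hs0 hs1, hFactor] at h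
  rw [riemannZeta_def_of_ne_zero hs0]
  field_simp
  rw [← mul_right_inj' h1]
  linear_combination -h

/-! ### The character modulo four -/

lemma chi4_apply_nat (n : ℕ) : chi4 (n : ZMod 4) = ((ZMod.χ₄ (n : ZMod 4) : ℤ) : ℂ) := by
  simp [chi4, MulChar.ringHomComp_apply]

lemma chi4_ne_one : chi4 ≠ 1 := by
  intro h
  have h3 := chi4_apply_nat 3
  rw [h, MulChar.one_apply (by decide)] at h3
  have : (ZMod.χ₄ ((3 : ℕ) : ZMod 4)) = -1 := by decide
  rw [this] at h3
  norm_num at h3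

lemma chi4_odd : chi4.Odd := by
  have h : (-1 : ZMod 4) = ((3 : ℕ) : ZMod 4) := by decide
  have h3 : (ZMod.χ₄ ((3 : ℕ) : ZMod 4)) = -1 := by decide
  rw [DirichletCharacter.Odd, h, chi4_apply_nat, h3]
  norm_num

lemma chi4_inv : chi4⁻¹ = chi4 := by
  ext x
  rw [MulChar.inv_apply_eq_inv']
  simp only [chi4, MulChar.ringHomComp_apply]
  have : ∀ x : ZMod 4, ZMod.χ₄ x = 0 ∨ ZMod.χ₄ x = 1 ∨ ZMod.χ₄ x = -1 := by decide
  rcases this x with h | h | h <;> rw [h] <;> norm_num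

lemma chi4_isPrimitive : chi4.IsPrimitive := by
  rw [DirichletCharacter.IsPrimitive]
  have hd := chi4.conductor_dvd_level
  have hf := chi4.factorsThrough_conductor
  have hle := Nat.le_of_dvd (by norm_num) hd
  interval_cases h : chi4.conductor
  · norm_num at hd
  · exact absurd ((DirichletCharacter.factorsThrough_one_iff _).1 hf) chi4_ne_one
  -- The unit group modulo 2 is trivial, so a character factoring through level 2 would be
  -- principal.
  · obtain ⟨_, χ, hχ⟩ := hf
    have : χ = 1 := by
      ext u
      have : u = 1 := by revert u; decide
      simp [this]
    rw [this, DirichletCharacter.changeLevel_one] at hχ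
    exact absurd hχ chi4_ne_one
  · norm_num at hd
  · rfl

lemma tsum_mul_cpow_eq_pairedSeries {c : ℕ → ℂ} (h0 : ∀ k, c (2 * k) = 0)
    (h1 : ∀ k, c (4 * k + 1) = 1) (h3 : ∀ k, c (4 * k + 3) = -1) {z : ℂ} (hz : 1 < z.re) :
    ∑' n : ℕ, c n * (n : ℂ) ^ (-z) = pairedSeries 4 1 3 z := by
  have hA := summable_progression_cpow (m := 4) (by norm_num) hz 1
  have hB := summable_progression_cpow (m := 4) (by norm_num) hz 3
  have hodd1 : (fun k : ℕ => c (2 * (2 * k) + 1) * ((2 * (2 * k) + 1 : ℕ) : ℂ) ^ (-z)) =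
      fun k : ℕ => ((4 * k + 1 : ℕ) : ℂ) ^ (-z) := by
    funext k
    rw [show 2 * (2 * k) + 1 = 4 * k + 1 by ring, h1, one_mul]
  have hodd3 : (fun k : ℕ => c (2 * (2 * k + 1) + 1) *
      ((2 * (2 * k + 1) + 1 : ℕ) : ℂ) ^ (-z)) = fun k : ℕ => -((4 * k + 3 : ℕ) : ℂ) ^ (-z) := by
    funext k
    rw [show 2 * (2 * k + 1) + 1 = 4 * k + 3 by ring, h3, neg_one_mul]
  have hs1 : Summable fun k : ℕ => c (2 * (2 * k) + 1) * ((2 * (2 * k) + 1 : ℕ) : ℂ) ^ (-z) := by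
    rw [hodd1]; exact hA
  have hs3 : Summable fun k : ℕ => c (2 * (2 * k + 1) + 1) *
      ((2 * (2 * k + 1) + 1 : ℕ) : ℂ) ^ (-z) := by
    rw [hodd3]; exact hB.neg
  have hodd := tsum_even_add_odd (f := fun k : ℕ =>
    c (2 * k + 1) * ((2 * k + 1 : ℕ) : ℂ) ^ (-z)) hs1 hs3
  have hsodd : Summable fun k : ℕ => c (2 * k + 1) * ((2 * k + 1 : ℕ) : ℂ) ^ (-z) :=
    (HasSum.even_add_odd (f := fun k : ℕ => c (2 * k + 1) * ((2 * k + 1 : ℕ) : ℂ) ^ (-z))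
      hs1.hasSum hs3.hasSum).summable
  have heven : (fun k : ℕ => c (2 * k) * ((2 * k : ℕ) : ℂ) ^ (-z)) = fun _ => 0 := by
    funext k; rw [h0, zero_mul]
  rw [← tsum_even_add_odd (f := fun n : ℕ => c n * (n : ℂ) ^ (-z))
    (by rw [heven]; exact summable_zero) hsodd, heven, tsum_zero, zero_add, ← hodd, hodd1, hodd3,
    tsum_neg, ← sub_eq_add_neg, pairedSeries, hA.tsum_sub hB]

lemma pairedSeries_four_one_three {s : ℂ} (hs : 0 < s.re) :
    pairedSeries 4 1 3 s = dirichletL s := by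
  refine eqOn_re_pos (fun z hz => (differentiableAt_pairedSeries le_rfl (by norm_num)
    (by norm_num) hz).differentiableWithinAt)
    (DirichletCharacter.differentiable_LFunction chi4_ne_one).differentiableOn
    (fun z hz => ?_) hs
  rw [DirichletCharacter.LFunction_eq_LSeries _ hz, LSeries,
    ← tsum_mul_cpow_eq_pairedSeries (c := fun n => chi4 n) (fun k => ?_) (fun k => ?_)
      (fun k => ?_) hz]
  · refine tsum_congr fun n => ?_
    rw [LSeries.term_def₀ (by simp [chi4, MulChar.ringHomComp_apply])]
  · rw [chi4_apply_nat, ZMod.χ₄_nat_eq_if_mod_four, if_pos (by lia), Int.cast_zero]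
  · rw [chi4_apply_nat, ZMod.χ₄_nat_eq_if_mod_four, if_neg (by lia), if_pos (by lia), Int.cast_one]
  · rw [chi4_apply_nat, ZMod.χ₄_nat_eq_if_mod_four, if_neg (by lia), if_neg (by lia), Int.cast_neg,
      Int.cast_one]

/-! ### The entire function -/

/-- The completed function of `chi4`. -/
noncomputable def completedL : ℂ → ℂ := chi4.completedLFunction

lemma differentiable_completedL : Differentiable ℂ completedL :=
  DirichletCharacter.differentiable_completedLFunction chi4_ne_one

lemma dirichletL_eq_div (s : ℂ) : dirichletL s = completedL s / Complex.Gammaℝ (s + 1) := by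
  rw [dirichletL, DirichletCharacter.LFunction_eq_completed_div_gammaFactor _ _
    (Or.inr (by norm_num)), chi4_odd.gammaFactor_def, completedL]

lemma completedL_eq_mul {s : ℂ} (hs : 0 < s.re) :
    completedL s = Complex.Gammaℝ (s + 1) * pairedSeries 4 1 3 s := by
  have h : Complex.Gammaℝ (s + 1) ≠ 0 := Complex.Gammaℝ_ne_zero_of_re_pos (by simp; linarith)
  rw [pairedSeries_four_one_three hs, dirichletL_eq_div]
  field_simp

/-- The root number need not be computed as a Gauss sum: at the fixed point s = 1/2 the functional
equation forces it to be 1, because L(1/2) ≠ 0 by positivity of the paired series. -/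
lemma completedL_one_sub (s : ℂ) :
    completedL (1 - s) = (4 : ℂ) ^ (s - 1 / 2) * completedL s := by
  have h := fun s => chi4_isPrimitive.completedLFunction_one_sub s
  rw [chi4_inv] at h
  have h2 : completedL (1 / 2) ≠ 0 := by
    rw [completedL_eq_mul (by norm_num)]
    refine mul_ne_zero (Complex.Gammaℝ_ne_zero_of_re_pos (by norm_num)) ?_
    have := pairedSeries_ofReal_ne_zero (m := 4) (a := 1) (b := 3) le_rfl (by norm_num)
      (by norm_num) (x := 1 / 2) (by norm_num)
    simpa using this
  have hW : chi4.rootNumber = 1 := by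
    have h3 := h (1 / 2)
    rw [show (1 : ℂ) - 1 / 2 = 1 / 2 by norm_num, sub_self, Complex.cpow_zero, one_mul] at h3
    exact (mul_eq_right₀ h2).1 h3.symm
  have h4 := h s
  rw [hW, mul_one] at h4
  exact_mod_cast h4

/-- A closed form of `E` without removable singularities. -/
noncomputable def entireE (s : ℂ) : ℂ := (2 : ℂ) ^ s / 2 * hCompletedZeta s * completedL s

lemma differentiable_entireE : Differentiable ℂ entireE :=
  ((differentiable_two_cpow.div_const 2).mul differentiable_hCompletedZeta).mul
    differentiable_completedL

lemma entireE_one_sub (s : ℂ) : entireE (1 - s) = entireE s := by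
  rw [entireE, entireE, hCompletedZeta_one_sub, completedL_one_sub]
  have h4 : (4 : ℂ) ^ (s - 1 / 2) = (2 : ℂ) ^ (s - 1 / 2) * (2 : ℂ) ^ (s - 1 / 2) := by
    have := Complex.natCast_mul_natCast_cpow 2 2 (s - 1 / 2)
    norm_num at this ⊢
    exact this
  have h : (2 : ℂ) ^ (1 - s) * (4 : ℂ) ^ (s - 1 / 2) = (2 : ℂ) ^ s := by
    rw [h4, ← Complex.cpow_add _ _ two_ne_zero, ← Complex.cpow_add _ _ two_ne_zero]
    congr 1; ring
  rw [← h]; ring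

/-- Γ has no zeros and takes the default value 0 at its poles, so the second hypothesis excludes
exactly 0, -1, -2, …. -/
lemma formula_eq_entireE {s : ℂ} (hs1 : s ≠ 1) (hs : Complex.Gamma s ≠ 0) :
    formula s = entireE s := by
  have hs0 : s ≠ 0 := by rintro rfl; simp at hs
  have hpi : ((2 : ℂ) * (Real.pi : ℂ)) ^ (-s) = ((2 : ℂ) ^ s * (Real.pi : ℂ) ^ s)⁻¹ := by
    rw [Complex.cpow_neg]
    congr 1
    have := Complex.mul_cpow_ofReal_nonneg (a := 2) (b := Real.pi) zero_le_two Real.pi_pos.le s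
    exact_mod_cast this
  have hG : Complex.Gammaℂ s ≠ 0 := by
    rw [Complex.Gammaℂ_def, hpi]
    refine mul_ne_zero (mul_ne_zero two_ne_zero (inv_ne_zero (mul_ne_zero ?_ ?_))) hs
    · simp [Complex.cpow_eq_zero_iff]
    · simp [Complex.cpow_eq_zero_iff, Real.pi_ne_zero]
  have h2 : (2 : ℂ) ^ s ≠ 0 := by simp [Complex.cpow_eq_zero_iff]
  have hp : (Real.pi : ℂ) ^ s ≠ 0 := by simp [Complex.cpow_eq_zero_iff, Real.pi_ne_zero]
  rw [formula, entireE, hCompletedZeta_eq hs0 hs1, dirichletL_eq_div,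
    riemannZeta_def_of_ne_zero hs0]
  have hGG := Complex.Gammaℝ_mul_Gammaℝ_add_one s
  have h1 : Complex.Gammaℝ s ≠ 0 := fun h => hG (by rw [← hGG, h, zero_mul])
  have h1' : Complex.Gammaℝ (s + 1) ≠ 0 := fun h => hG (by rw [← hGG, h, mul_zero])
  rw [Complex.Gammaℂ_def, hpi] at hGG
  have hΓ : Complex.Gamma s = (2 : ℂ) ^ s * (Real.pi : ℂ) ^ s / 2 *
      (Complex.Gammaℝ s * Complex.Gammaℝ (s + 1)) := by
    rw [hGG]; field_simp
  rw [hΓ]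
  field_simp

/-- The excluded points are isolated, being 1 and the zeros of the entire function 1/Γ, which is not
identically zero. -/
lemma eventually_formula_eq_entireE (s : ℂ) : ∀ᶠ w in 𝓝[≠] s, formula w = entireE w := by
  have h1 : ∀ᶠ w in 𝓝[≠] s, w ≠ 1 := by
    rcases eq_or_ne s 1 with rfl | h
    · exact self_mem_nhdsWithin
    · exact nhdsWithin_le_nhds (isOpen_ne.mem_nhds h)
  have han : AnalyticOnNhd ℂ (fun s => (Complex.Gamma s)⁻¹) Set.univ :=
    Complex.differentiable_one_div_Gamma.differentiableOn.analyticOnNhd isOpen_univ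
  have h2 : ∀ᶠ w in 𝓝[≠] s, (Complex.Gamma w)⁻¹ ≠ 0 := by
    refine ((han s trivial).eventually_eq_zero_or_eventually_ne_zero).resolve_left fun h => ?_
    have := han.eqOn_of_preconnected_of_eventuallyEq (g := fun _ => 0)
      analyticOnNhd_const isPreconnected_univ (Set.mem_univ s) h (Set.mem_univ 1)
    simp at this
  filter_upwards [h1, h2] with w hw1 hw2
  exact formula_eq_entireE hw1 fun h => hw2 (by rw [h, inv_zero])

lemma E_eq_entireE : E = entireE := by
  funext s
  refine Filter.Tendsto.limUnder_eq (((differentiable_entireE s).continuousAt.tendsto.mono_left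
    nhdsWithin_le_nhds).congr' ?_)
  filter_upwards [eventually_formula_eq_entireE s] with w hw using hw.symm

lemma differentiable_E : Differentiable ℂ E := E_eq_entireE ▸ differentiable_entireE

lemma E_one_sub (s : ℂ) : E (1 - s) = E s := by rw [E_eq_entireE, entireE_one_sub]

/-! ### The factorisation in the right half-plane -/

/-- The Dirichlet series part of `E` in the right half-plane. -/
noncomputable def seriesPart (s : ℂ) : ℂ :=
  (1 - (2 : ℂ) ^ (-s)) * pairedSeries 2 1 2 s * pairedSeries 4 1 3 s

/-- The archimedean part of `E`. -/
noncomputable def gammaPart (s : ℂ) : ℂ :=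
  -((2 : ℂ) ^ s / (Real.pi : ℂ) ^ s) * Complex.Gamma s

/-- Writing 1-2^s = -2^s (1-2^(-s)) moves the exponential growth into the archimedean part; what
remains grows polynomially and stays away from 0 on σ = 2. -/
lemma E_eq_mul {s : ℂ} (hs : 0 < s.re) : E s = gammaPart s * seriesPart s := by
  have hpi : ((2 : ℂ) * (Real.pi : ℂ)) ^ (-s) = ((2 : ℂ) ^ s * (Real.pi : ℂ) ^ s)⁻¹ := by
    rw [Complex.cpow_neg]
    congr 1
    have := Complex.mul_cpow_ofReal_nonneg (a := 2) (b := Real.pi) zero_le_two Real.pi_pos.le s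
    exact_mod_cast this
  have h2 : (2 : ℂ) ^ s ≠ 0 := by simp [Complex.cpow_eq_zero_iff]
  have hp : (Real.pi : ℂ) ^ s ≠ 0 := by simp [Complex.cpow_eq_zero_iff, Real.pi_ne_zero]
  have hGG := Complex.Gammaℝ_mul_Gammaℝ_add_one s
  rw [Complex.Gammaℂ_def, hpi] at hGG
  rw [E_eq_entireE, entireE, hCompletedZeta_eq_pairedSeries hs, completedL_eq_mul hs, gammaPart,
    seriesPart, Complex.cpow_neg]
  have : ∀ X Y : ℂ, (2 : ℂ) ^ s / 2 * ((1 - (2 : ℂ) ^ s) * s.Gammaℝ * X) *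
      ((s + 1).Gammaℝ * Y) = (2 : ℂ) ^ s / 2 * (1 - (2 : ℂ) ^ s) *
        (s.Gammaℝ * (s + 1).Gammaℝ) * X * Y := fun X Y => by ring
  rw [this, hGG]
  field_simp
  ring

lemma gammaPart_ne_zero {s : ℂ} (hs : 0 < s.re) : gammaPart s ≠ 0 := by
  refine mul_ne_zero (neg_ne_zero.2 (div_ne_zero ?_ ?_)) (Complex.Gamma_ne_zero_of_re_pos hs)
  · simp [Complex.cpow_eq_zero_iff]
  · simp [Complex.cpow_eq_zero_iff, Real.pi_ne_zero]

lemma ofReal_cpow_conj {x : ℝ} (hx : 0 ≤ x) (s : ℂ) :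
    (x : ℂ) ^ ((starRingEnd ℂ) s) = (starRingEnd ℂ) ((x : ℂ) ^ s) := by
  rw [Complex.cpow_conj _ _ (by rw [Complex.arg_ofReal_of_nonneg hx]; exact Real.pi_pos.ne),
    Complex.conj_ofReal]

lemma E_conj_of_re_pos {s : ℂ} (hs : 0 < s.re) :
    E ((starRingEnd ℂ) s) = (starRingEnd ℂ) (E s) := by
  have h2 : ∀ s : ℂ, (2 : ℂ) ^ ((starRingEnd ℂ) s) = (starRingEnd ℂ) ((2 : ℂ) ^ s) := fun s => by
    simpa using ofReal_cpow_conj (x := 2) zero_le_two s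
  rw [E_eq_mul hs, E_eq_mul (by simpa using hs), gammaPart, gammaPart, seriesPart, seriesPart,
    pairedSeries_conj, pairedSeries_conj, Complex.Gamma_conj, h2, ← map_neg (starRingEnd ℂ) s, h2,
    ofReal_cpow_conj Real.pi_pos.le]
  simp

lemma E_conj (s : ℂ) : E ((starRingEnd ℂ) s) = (starRingEnd ℂ) (E s) := by
  rcases lt_or_ge 0 s.re with hs | hs
  · exact E_conj_of_re_pos hs
  · have h := E_conj_of_re_pos (s := 1 - s) (by simp; linarith)
    rwa [E_one_sub, map_sub, map_one, E_one_sub] at h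

lemma E_one_sub_conj (s : ℂ) : E (1 - (starRingEnd ℂ) s) = (starRingEnd ℂ) (E s) := by
  rw [E_one_sub, E_conj]

/-! ### The location of the zeros -/

lemma seriesPart_ne_zero_of_one_lt_re {s : ℂ} (hs : 1 < s.re) : seriesPart s ≠ 0 := by
  have hs1 : s ≠ 1 := by rintro rfl; norm_num at hs
  rw [seriesPart, pairedSeries_two_one_two (by linarith) hs1,
    pairedSeries_four_one_three (by linarith)]
  refine mul_ne_zero (mul_ne_zero (one_sub_two_cpow_ne_zero (by simp; linarith))
    (mul_ne_zero (one_sub_two_cpow_ne_zero (by simp; linarith))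
    (riemannZeta_ne_zero_of_one_le_re hs.le))) ?_
  exact DirichletCharacter.LFunction_ne_zero_of_one_le_re _ (Or.inl chi4_ne_one) hs.le

lemma E_ne_zero_of_one_lt_re {s : ℂ} (hs : 1 < s.re) : E s ≠ 0 := by
  rw [E_eq_mul (by linarith)]
  exact mul_ne_zero (gammaPart_ne_zero (by linarith)) (seriesPart_ne_zero_of_one_lt_re hs)

lemma re_mem_Icc_of_E_eq_zero {s : ℂ} (hs : E s = 0) : 0 ≤ s.re ∧ s.re ≤ 1 := by
  constructor
  · by_contra! h
    exact E_ne_zero_of_one_lt_re (s := 1 - s) (by simp; linarith) (by rw [E_one_sub, hs])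
  · by_contra! h
    exact E_ne_zero_of_one_lt_re h hs

lemma E_ofReal_ne_zero_of_pos {x : ℝ} (hx : 0 < x) : E (x : ℂ) ≠ 0 := by
  have hx' : 0 < (x : ℂ).re := by simpa using hx
  rw [E_eq_mul hx']
  exact mul_ne_zero (gammaPart_ne_zero hx') (mul_ne_zero (mul_ne_zero
    (one_sub_two_cpow_ne_zero (by simpa using hx.ne'))
    (pairedSeries_ofReal_ne_zero le_rfl (by norm_num) (by norm_num) hx))
    (pairedSeries_ofReal_ne_zero le_rfl (by norm_num) (by norm_num) hx))

lemma E_ofReal_ne_zero (x : ℝ) : E (x : ℂ) ≠ 0 := by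
  rcases lt_or_ge 0 x with hx | hx
  · exact E_ofReal_ne_zero_of_pos hx
  · have := E_ofReal_ne_zero_of_pos (x := 1 - x) (by linarith)
    rwa [Complex.ofReal_sub, Complex.ofReal_one, E_one_sub] at this

lemma im_ne_zero_of_E_eq_zero {s : ℂ} (hs : E s = 0) : s.im ≠ 0 := fun h =>
  E_ofReal_ne_zero s.re (by
    rwa [show ((s.re : ℝ) : ℂ) = s from Complex.ext (by simp) (by simp [h])])

lemma E_eq_of_ne {s : ℂ} (h0 : s ≠ 0) (h1 : s ≠ 1) :
    E s = (2 : ℂ) ^ s / 2 * (hFactor s * completedRiemannZeta s) * completedL s := by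
  rw [E_eq_entireE, entireE, hCompletedZeta_eq h0 h1]

lemma E_eq_zero_iff (s : ℂ) : E s = 0 ↔
    (s.im ≠ 0 ∧ hFactor s = 0) ∨ IsNontrivialZetaZero s ∨ IsNontrivialLZero s := by
  have hne : ∀ {s : ℂ}, s.im ≠ 0 → s ≠ 0 ∧ s ≠ 1 := fun h =>
    ⟨by rintro rfl; simp at h, by rintro rfl; simp at h⟩
  have h2 : (2 : ℂ) ^ s / 2 ≠ 0 :=
    div_ne_zero (by simp [Complex.cpow_eq_zero_iff]) two_ne_zero
  constructor
  · intro h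
    have him := im_ne_zero_of_E_eq_zero h
    have hre := re_mem_Icc_of_E_eq_zero h
    obtain ⟨h0, h1⟩ := hne him
    rw [E_eq_of_ne h0 h1] at h
    rcases mul_eq_zero.1 h with h | h
    · rcases mul_eq_zero.1 ((mul_eq_zero.1 h).resolve_left h2) with h | h
      · exact Or.inl ⟨him, h⟩
      · refine Or.inr (Or.inl ⟨h1, by rw [riemannZeta_def_of_ne_zero h0, h, zero_div], ?_⟩)
        rintro ⟨n, rfl⟩
        exact him (by simp)
    · refine Or.inr (Or.inr ⟨by rw [dirichletL_eq_div, h, zero_div], ?_⟩)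
      rintro ⟨n, rfl⟩
      exact him (by simp)
  · rintro (⟨him, h⟩ | ⟨h1, hz, hn⟩ | ⟨hz, hn⟩)
    · obtain ⟨h0, h1⟩ := hne him
      rw [E_eq_of_ne h0 h1, h]; simp
    · have h0 : s ≠ 0 := by
        rintro rfl
        rw [riemannZeta_zero] at hz
        norm_num at hz
      -- Since x/0 = 0, the second alternative is a pole of Γ_ℝ, that is s = -2n. The value n = 0 is
      -- ruled out by ζ(0) ≠ 0, and n ≥ 1 gives the trivial zeros. The case of L below is analogous.
      rw [riemannZeta_def_of_ne_zero h0, div_eq_zero_iff] at hz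
      rcases hz with hz | hz
      · rw [E_eq_of_ne h0 h1, hz]; simp
      · obtain ⟨n, rfl⟩ := Complex.Gammaℝ_eq_zero_iff.1 hz
        rcases n with _ | n
        · simp at h0
        · exact absurd ⟨n, by push_cast; ring⟩ hn
    · rw [dirichletL_eq_div, div_eq_zero_iff] at hz
      rcases hz with hz | hz
      · rw [E_eq_entireE, entireE, hz, mul_zero]
      · obtain ⟨n, hn'⟩ := Complex.Gammaℝ_eq_zero_iff.1 hz
        exact absurd ⟨n, by linear_combination hn'⟩ hn

end EReversed

namespace EReversed

/-! ### Complex analysis: logarithms, factorisations, variation of the argument -/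

/-- Where `exp u` is real, `Im u` lies in πℤ, so by the intermediate value theorem it is constant.
Applied to differences of logarithms, this compares arguments along a segment. -/
lemma im_eq_of_exp_im_eq_zero {u : ℝ → ℂ} {a b : ℝ} (hu : ContinuousOn u (Set.uIcc a b))
    (h : ∀ x ∈ Set.uIcc a b, (Complex.exp (u x)).im = 0) : (u a).im = (u b).im := by
  have hint : ∀ x ∈ Set.uIcc a b, ∃ n : ℤ, (u x).im / Real.pi = n := by
    intro x hx
    have h1 := h x hx
    rw [Complex.exp_im, mul_eq_zero] at h1
    obtain ⟨n, hn⟩ := Real.sin_eq_zero_iff.1 (h1.resolve_left (Real.exp_pos _).ne')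
    exact ⟨n, by rw [← hn, mul_div_cancel_right₀ _ Real.pi_ne_zero]⟩
  have hc : ContinuousOn (fun x => (u x).im / Real.pi) (Set.uIcc a b) :=
    (Complex.continuous_im.comp_continuousOn hu).div_const _
  have hivt := intermediate_value_uIcc hc
  obtain ⟨p, hp⟩ := hint a Set.left_mem_uIcc
  obtain ⟨q, hq⟩ := hint b Set.right_mem_uIcc
  simp only [hp, hq] at hivt
  have key : ∀ v : ℝ, v ∈ Set.uIcc (p : ℝ) q → ∃ n : ℤ, v = n := by
    intro v hv
    obtain ⟨x, hx, hxv⟩ := hivt hv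
    obtain ⟨n, hn⟩ := hint x hx
    exact ⟨n, by rw [← hxv]; exact hn⟩
  have hpq : p = q := by
    rcases lt_trichotomy p q with hlt | heq | hlt
    · have h1 : (p : ℝ) + 1 ≤ q := by exact_mod_cast hlt
      obtain ⟨n, hn⟩ := key (p + 1 / 2) (Set.mem_uIcc.2 (Or.inl ⟨by linarith, by linarith⟩))
      have h2 : (2 * p + 1 : ℝ) = 2 * n := by linarith
      have h3 : 2 * p + 1 = 2 * n := by exact_mod_cast h2
      lia
    · exact heq
    · have h1 : (q : ℝ) + 1 ≤ p := by exact_mod_cast hlt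
      obtain ⟨n, hn⟩ := key (p - 1 / 2) (Set.mem_uIcc.2 (Or.inr ⟨by linarith, by linarith⟩))
      have h2 : (2 * p - 1 : ℝ) = 2 * n := by linarith
      have h3 : 2 * p - 1 = 2 * n := by exact_mod_cast h2
      lia
  rw [hpq, ← hq] at hp
  exact (div_left_inj' Real.pi_ne_zero).1 hp

/-- Take a primitive G of f'/f on the disc; then f·exp(-G) is constant, and a constant shift of G is
a logarithm. -/
lemma exists_log_of_differentiableOn_ball {f : ℂ → ℂ} {c : ℂ} {r : ℝ}
    (hf : DifferentiableOn ℂ f (Metric.ball c r)) (h0 : ∀ z ∈ Metric.ball c r, f z ≠ 0) :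
    ∃ H : ℂ → ℂ, DifferentiableOn ℂ H (Metric.ball c r) ∧
      ∀ z ∈ Metric.ball c r, Complex.exp (H z) = f z := by
  rcases le_or_gt r 0 with hr | hr
  · exact ⟨0, by simp [Metric.ball_eq_empty.2 hr], by simp [Metric.ball_eq_empty.2 hr]⟩
  have hc : c ∈ Metric.ball c r := Metric.mem_ball_self hr
  obtain ⟨G, hG⟩ := ((hf.deriv Metric.isOpen_ball).div hf h0).isExactOn_ball
  have hd : ∀ z ∈ Metric.ball c r,
      HasDerivAt (fun z => f z * Complex.exp (-G z)) 0 z := by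
    intro z hz
    have h1 := (hf.differentiableAt (Metric.isOpen_ball.mem_nhds hz)).hasDerivAt
    have h2 := h1.mul (hG z hz).neg.cexp
    have h3 : deriv f z * Complex.exp (-G z) +
        f z * (Complex.exp (-G z) * -(deriv f z / f z)) = 0 := by
      have := h0 z hz
      field_simp
      ring
    exact h3 ▸ h2
  have hconst : ∀ z ∈ Metric.ball c r,
      f z * Complex.exp (-G z) = f c * Complex.exp (-G c) := fun z hz =>
    Metric.isOpen_ball.is_const_of_deriv_eq_zero (convex_ball c r).isPreconnected
      (fun w hw => (hd w hw).differentiableAt.differentiableWithinAt)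
      (fun w hw => (hd w hw).deriv) hz hc
  refine ⟨fun z => G z - G c + Complex.log (f c),
    fun z hz => (((hG z hz).differentiableAt.sub_const _).add_const _).differentiableWithinAt,
    fun z hz => ?_⟩
  rw [Complex.exp_add, Complex.exp_log (h0 c hc), Complex.exp_sub]
  have := hconst z hz
  rw [Complex.exp_neg, Complex.exp_neg] at this
  field_simp at this ⊢
  linear_combination -this

/-- Zeros are divided out one at a time. The factors already removed do not vanish at the next zero,
so its order in the cofactor is still its order in f. -/
lemma exists_eq_prod_mul {f : ℂ → ℂ} {U : Set ℂ} (hf : AnalyticOnNhd ℂ f U) (S : Finset ℂ)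
    (hS : (S : Set ℂ) ⊆ U) (hord : ∀ ρ ∈ S, analyticOrderAt f ρ ≠ ⊤) :
    ∃ g : ℂ → ℂ, AnalyticOnNhd ℂ g U ∧
      (∀ z, f z = (∏ ρ ∈ S, (z - ρ) ^ analyticOrderNatAt f ρ) * g z) ∧ ∀ ρ ∈ S, g ρ ≠ 0 := by
  classical
  induction S using Finset.induction_on with
  | empty => exact ⟨f, hf, by simp, by simp⟩
  | insert ρ S hρ ih =>
    obtain ⟨g, hg, hfg, hgS⟩ := ih (fun x hx => hS (Finset.mem_insert_of_mem hx))
      (fun x hx => hord x (Finset.mem_insert_of_mem hx))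
    have hρU : ρ ∈ U := hS (Finset.mem_insert_self _ _)
    set P : ℂ → ℂ := fun z => ∏ x ∈ S, (z - x) ^ analyticOrderNatAt f x with hP
    have hPan : AnalyticAt ℂ P ρ := by
      have : Differentiable ℂ P := by
        rw [hP]
        fun_prop
      exact this.differentiableOn.analyticOnNhd isOpen_univ ρ trivial
    have hP0 : P ρ ≠ 0 := Finset.prod_ne_zero_iff.2 fun x hx =>
      pow_ne_zero _ (sub_ne_zero.2 (by rintro rfl; exact hρ hx))
    have hfPg : f = P * g := funext hfg
    have horder : analyticOrderAt g ρ = analyticOrderAt f ρ := by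
      rw [hfPg, analyticOrderAt_mul hPan (hg ρ hρU), hPan.analyticOrderAt_eq_zero.2 hP0, zero_add]
    have hnat : analyticOrderNatAt g ρ = analyticOrderNatAt f ρ := by
      rw [analyticOrderNatAt, analyticOrderNatAt, horder]
    obtain ⟨k, hk, hk0, hgk⟩ := (hg ρ hρU).analyticOrderAt_ne_top.1
      (horder ▸ hord ρ (Finset.mem_insert_self _ _))
    rw [hnat] at hgk
    set n := analyticOrderNatAt f ρ with hn
    -- The pointwise quotient does not give the right value at ρ when n > 0, so the value of the
    -- local cofactor is inserted there.
    set K : ℂ → ℂ := Function.update (fun z => g z / (z - ρ) ^ n) ρ (k ρ) with hK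
    have hKne : ∀ z, z ≠ ρ → K z = g z / (z - ρ) ^ n := fun z hz => Function.update_of_ne hz _ _
    have hKρ : K ρ = k ρ := Function.update_self _ _ _
    have hKk : K =ᶠ[𝓝 ρ] k := by
      filter_upwards [hgk] with z hz
      rcases eq_or_ne z ρ with rfl | hzρ
      · exact hKρ
      · rw [hKne z hzρ, hz, smul_eq_mul,
          mul_div_cancel_left₀ _ (pow_ne_zero _ (sub_ne_zero.2 hzρ))]
    refine ⟨K, fun z hz => ?_, fun z => ?_, fun x hx => ?_⟩
    · rcases eq_or_ne z ρ with rfl | hzρ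
      · exact hk.congr hKk.symm
      · have h1 : AnalyticAt ℂ (fun z => g z / (z - ρ) ^ n) z :=
          (hg z hz).div ((analyticAt_id.sub analyticAt_const).pow n)
            (pow_ne_zero _ (sub_ne_zero.2 hzρ))
        refine h1.congr ?_
        filter_upwards [isOpen_ne.mem_nhds hzρ] with w hw using (hKne w hw).symm
    · rw [Finset.prod_insert hρ, hfg z]
      rcases eq_or_ne z ρ with rfl | hzρ
      · have h2 : g z = (z - z) ^ n * k z := hgk.self_of_nhds
        rw [h2, hKρ]
        ring
      · rw [hKne z hzρ]
        have := pow_ne_zero n (sub_ne_zero.2 hzρ)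
        rw [← hn]
        field_simp
    · rcases Finset.mem_insert.1 hx with rfl | hxS
      · rwa [hKρ]
      · have hxρ : x ≠ ρ := by rintro rfl; exact hρ hxS
        rw [hKne x hxρ]
        exact div_ne_zero (hgS x hxS) (pow_ne_zero _ (sub_ne_zero.2 hxρ))

lemma frequently_of_analyticOrderAt_eq_top {f : ℂ → ℂ} {z : ℂ} (h : analyticOrderAt f z = ⊤) :
    ∃ᶠ w in 𝓝[≠] z, f w = 0 :=
  (((analyticOrderAt_eq_top.1 h).filter_mono nhdsWithin_le_nhds)).frequently

lemma analyticOrderAt_ne_top_of_ne_zero {f : ℂ → ℂ} {U : Set ℂ} (hf : AnalyticOnNhd ℂ f U)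
    (hU : IsPreconnected U) {w : ℂ} (hw : w ∈ U) (hfw : f w ≠ 0) {z : ℂ} (hz : z ∈ U) :
    analyticOrderAt f z ≠ ⊤ := fun h =>
  hfw (hf.eqOn_zero_of_preconnected_of_frequently_eq_zero hU hz
    (frequently_of_analyticOrderAt_eq_top h) hw)

lemma finite_zeros_of_isCompact {f : ℂ → ℂ} {U K : Set ℂ} (hf : AnalyticOnNhd ℂ f U)
    (hU : IsPreconnected U) {w : ℂ} (hw : w ∈ U) (hfw : f w ≠ 0) (hK : IsCompact K)
    (hKU : K ⊆ U) : {z | z ∈ K ∧ f z = 0}.Finite := by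
  by_contra hinf
  obtain ⟨z, hz, hacc⟩ := Set.Infinite.exists_accPt_of_subset_isCompact
    (s := {z | z ∈ K ∧ f z = 0}) hinf hK (fun x hx => hx.1)
  refine hfw (hf.eqOn_zero_of_preconnected_of_frequently_eq_zero hU (hKU hz) ?_ hw)
  exact (accPt_iff_frequently_nhdsNE.1 hacc).mono fun x hx => hx.2

lemma abs_im_log_le (z : ℂ) : |(Complex.log z).im| ≤ Real.pi := by
  rw [Complex.log_im]; exact Complex.abs_arg_le_pi z

lemma norm_blaschke_numerator {R : ℝ} (hR : 0 < R) {ρ z : ℂ} (hz : ‖z‖ = R) :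
    ‖((R : ℂ) ^ 2 - (starRingEnd ℂ) ρ * z) / R‖ = ‖z - ρ‖ := by
  have h1 : (R : ℂ) ^ 2 = (starRingEnd ℂ) z * z := by
    rw [← Complex.normSq_eq_conj_mul_self, Complex.normSq_eq_norm_sq, hz]; push_cast; rfl
  rw [h1, ← sub_mul, ← map_sub, norm_div, norm_mul, Complex.norm_conj, hz, Complex.norm_real,
    Real.norm_eq_abs, abs_of_pos hR, mul_div_cancel_right₀ _ hR.ne']

/-- The variation of the argument along a radius is bounded in terms of the growth. -/
theorem exists_log_on_radius {r r₁ R : ℝ} (hr : 0 < r) (hr₁ : r < r₁) (hR : r₁ < R) :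
    ∃ C : ℝ, ∀ (f : ℂ → ℂ) (M : ℝ), AnalyticOnNhd ℂ f (Metric.closedBall 0 R) →
      (∀ z ∈ Metric.closedBall (0 : ℂ) R, ‖f z‖ ≤ M) →
      (∀ z ∈ Metric.closedBall (0 : ℂ) R, z.im = 0 → f z ≠ 0) →
      ∃ u : ℝ → ℂ, ContinuousOn u (Set.Icc (-r) 0) ∧
        (∀ x ∈ Set.Icc (-r) 0, Complex.exp (u x) = f x) ∧
        |(u (-r)).im - (u 0).im| ≤ C * (Real.log (M / ‖f 0‖) + 1) := by
  have hr1 : 0 < r₁ := hr.trans hr₁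
  have hR0 : 0 < R := hr1.trans hR
  have hlog : 0 < Real.log (R / r₁) := Real.log_pos ((one_lt_div hr1).2 hR)
  -- The first summand is 4π for each zero in the disc of radius `r₁`, times the Jensen bound for
  -- their number; the second comes from Borel–Carathéodory between the radii r and `r₁`.
  refine ⟨4 * Real.pi / Real.log (R / r₁) + 2 * r / (r₁ - r), fun f M hf hM hre => ?_⟩
  have h0mem : (0 : ℂ) ∈ Metric.closedBall (0 : ℂ) R := Metric.mem_closedBall_self hR0.le
  have hf0 : f 0 ≠ 0 := hre 0 h0mem rfl
  have hpre : IsPreconnected (Metric.closedBall (0 : ℂ) R) := (convex_closedBall _ _).isPreconnected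
  have hsub : Metric.closedBall (0 : ℂ) r₁ ⊆ Metric.closedBall 0 R :=
    Metric.closedBall_subset_closedBall hR.le
  have hfin := finite_zeros_of_isCompact hf hpre h0mem hf0
    (isCompact_closedBall (0 : ℂ) r₁) hsub
  set S : Finset ℂ := hfin.toFinset with hS
  have hSmem : ∀ ρ, ρ ∈ S ↔ ρ ∈ Metric.closedBall (0 : ℂ) r₁ ∧ f ρ = 0 := fun ρ => by
    rw [hS, Set.Finite.mem_toFinset]; rfl
  have hSnorm : ∀ ρ ∈ S, ‖ρ‖ ≤ r₁ := fun ρ hρ => by simpa using ((hSmem ρ).1 hρ).1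
  obtain ⟨g, hg, hfg, hgS⟩ := exists_eq_prod_mul hf S (fun ρ hρ => hsub ((hSmem ρ).1 hρ).1)
    (fun ρ hρ => analyticOrderAt_ne_top_of_ne_zero hf hpre h0mem hf0 (hsub ((hSmem ρ).1 hρ).1))
  set n : ℂ → ℕ := analyticOrderNatAt f with hn
  -- Blaschke numerator: it has the modulus of z - ρ on |z| = R and positive real part inside.
  -- Replacing each z - ρ by it gives `g2`, which has no zeros for |z| ≤ `r₁` and still obeys the
  -- bound M.
  set q : ℂ → ℂ → ℂ := fun ρ z => ((R : ℂ) ^ 2 - (starRingEnd ℂ) ρ * z) / R with hq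
  have hqre : ∀ ρ ∈ S, ∀ z : ℂ, ‖z‖ < R → 0 < (q ρ z).re := by
    intro ρ hρ z hz
    have h1 : ‖(starRingEnd ℂ) ρ * z‖ < R ^ 2 := by
      rw [norm_mul, Complex.norm_conj, sq]
      exact mul_lt_mul'' ((hSnorm ρ hρ).trans_lt hR) hz (norm_nonneg _) (norm_nonneg _)
    have h2 := (Complex.re_le_norm ((starRingEnd ℂ) ρ * z)).trans_lt h1
    have h3 : (q ρ z).re = (R ^ 2 - ((starRingEnd ℂ) ρ * z).re) / R := by
      simp only [hq]
      rw [Complex.div_ofReal_re, Complex.sub_re]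
      congr 2
      rw [← Complex.ofReal_pow, Complex.ofReal_re]
    rw [h3]
    exact div_pos (by linarith) hR0
  set g2 : ℂ → ℂ := fun z => (∏ ρ ∈ S, q ρ z ^ n ρ) * g z with hg2
  have hqd : ∀ ρ, Differentiable ℂ (q ρ) := fun ρ => by simp only [hq]; fun_prop
  have hg2an : AnalyticOnNhd ℂ g2 (Metric.closedBall 0 R) := by
    intro z hz
    have h1 : Differentiable ℂ fun z => ∏ ρ ∈ S, q ρ z ^ n ρ := by
      have := hqd
      fun_prop
    exact (h1.differentiableOn.analyticOnNhd isOpen_univ z trivial).mul (hg z hz)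
  have hg2bound : ∀ z ∈ Metric.closedBall (0 : ℂ) R, ‖g2 z‖ ≤ M := by
    have hdc : DiffContOnCl ℂ g2 (Metric.ball 0 R) :=
      DifferentiableOn.diffContOnCl (by
        rw [closure_ball _ hR0.ne']
        exact hg2an.differentiableOn)
    intro z hz
    refine Complex.norm_le_of_forall_mem_frontier_norm_le Metric.isBounded_ball hdc ?_
      (by rwa [closure_ball _ hR0.ne'])
    intro w hw
    rw [frontier_ball _ hR0.ne'] at hw
    have hwR : ‖w‖ = R := by simpa using hw
    refine le_trans (le_of_eq ?_) (hM w (Metric.sphere_subset_closedBall hw))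
    rw [hfg w]
    simp only [hg2, norm_mul, norm_prod, norm_pow, hq]
    congr 1
    exact Finset.prod_congr rfl fun ρ _ => by rw [norm_blaschke_numerator hR0 hwR]
  have hg2ne : ∀ z ∈ Metric.closedBall (0 : ℂ) r₁, g2 z ≠ 0 := by
    intro z hz
    have hz' : ‖z‖ < R := (by simpa using hz : ‖z‖ ≤ r₁).trans_lt hR
    refine mul_ne_zero (Finset.prod_ne_zero_iff.2 fun ρ hρ => pow_ne_zero _ fun h => ?_) ?_
    · have := hqre ρ hρ z hz'
      rw [h] at this
      simp at this
    · by_cases hzS : z ∈ S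
      · exact hgS z hzS
      · intro h
        exact hzS ((hSmem z).2 ⟨hz, by rw [hfg z, h, mul_zero]⟩)
  have hzero_mem1 : (0 : ℂ) ∈ Metric.closedBall (0 : ℂ) r₁ := Metric.mem_closedBall_self hr1.le
  set N : ℕ := ∑ ρ ∈ S, n ρ with hN
  have hg0 : ‖g 0‖ * R ^ N = ‖g2 0‖ := by
    simp only [hg2, norm_mul, norm_prod, norm_pow, hq]
    rw [mul_comm, hN, ← Finset.prod_pow_eq_pow_sum]
    congr 1
    refine Finset.prod_congr rfl fun ρ _ => ?_
    congr 1
    rw [mul_zero, sub_zero, sq, mul_div_assoc, div_self (by exact_mod_cast hR0.ne'), mul_one,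
      Complex.norm_real, Real.norm_eq_abs, abs_of_pos hR0]
  have hf0le : ‖f 0‖ ≤ r₁ ^ N * ‖g 0‖ := by
    rw [hfg 0, norm_mul, norm_prod, hN, ← Finset.prod_pow_eq_pow_sum]
    gcongr with ρ hρ
    rw [norm_pow, zero_sub, norm_neg]
    exact pow_le_pow_left₀ (norm_nonneg _) (hSnorm ρ hρ) _
  have hf0pos : 0 < ‖f 0‖ := norm_pos_iff.2 hf0
  -- Jensen's inequality: at 0 each exchanged factor grows from at most `r₁` to R, so N zeros cost a
  -- factor (R/r₁)^N against the bound M.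
  have hkey : ‖f 0‖ * (R / r₁) ^ N ≤ ‖g2 0‖ := by
    rw [← hg0, div_pow]
    calc ‖f 0‖ * (R ^ N / r₁ ^ N) ≤ (r₁ ^ N * ‖g 0‖) * (R ^ N / r₁ ^ N) := by gcongr
      _ = ‖g 0‖ * R ^ N := by field_simp
  have hone : 1 ≤ R / r₁ := ((one_lt_div hr1).2 hR).le
  have hf0g2 : ‖f 0‖ ≤ ‖g2 0‖ :=
    (le_mul_of_one_le_right hf0pos.le (one_le_pow₀ hone)).trans hkey
  have hMpos : 0 < M := hf0pos.trans_le (hM 0 h0mem)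
  set K : ℝ := Real.log (M / ‖f 0‖) with hK
  have hK0 : 0 ≤ K := Real.log_nonneg ((one_le_div hf0pos).2 (hM 0 h0mem))
  have hNK : (N : ℝ) ≤ K / Real.log (R / r₁) := by
    rw [le_div_iff₀ hlog, ← Real.log_pow, hK]
    refine Real.log_le_log (by positivity) ?_
    rw [le_div_iff₀ hf0pos, mul_comm]
    exact hkey.trans (hg2bound 0 h0mem)
  have hballs : Metric.ball (0 : ℂ) r₁ ⊆ Metric.closedBall 0 R :=
    Metric.ball_subset_closedBall.trans hsub
  obtain ⟨H, hH, hHexp⟩ := exists_log_of_differentiableOn_ball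
    (hg2an.differentiableOn.mono hballs) (fun z hz => hg2ne z (Metric.ball_subset_closedBall hz))
  have h0ball : (0 : ℂ) ∈ Metric.ball (0 : ℂ) r₁ := Metric.mem_ball_self hr1
  have hHre : ∀ z ∈ Metric.ball (0 : ℂ) r₁, (H z).re = Real.log ‖g2 z‖ := fun z hz => by
    rw [← hHexp z hz, Complex.norm_exp, Real.log_exp]
  -- K may be 0, while Borel–Carathéodory needs a positive bound; hence K + 1.
  have hmaps : Set.MapsTo (fun z => H z - H 0) (Metric.ball 0 r₁) {z | z.re ≤ K + 1} := by
    intro z hz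
    change (H z - H 0).re ≤ K + 1
    rw [Complex.sub_re, hHre z hz, hHre 0 h0ball, hK, Real.log_div hMpos.ne' hf0pos.ne']
    have h1 := Real.log_le_log (norm_pos_iff.2 (hg2ne z (Metric.ball_subset_closedBall hz)))
      (hg2bound z (hballs hz))
    have h2 := Real.log_le_log hf0pos hf0g2
    linarith
  have hrmem : ((-r : ℝ) : ℂ) ∈ Metric.ball (0 : ℂ) r₁ := by
    rw [mem_ball_zero_iff, Complex.norm_real, Real.norm_eq_abs, abs_neg, abs_of_pos hr]
    exact hr₁
  have hBC := Complex.borelCaratheodory_zero (by linarith : 0 < K + 1) (hH.sub_const (H 0)) hmaps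
    hr1 hrmem (sub_self _)
  rw [Complex.norm_real, Real.norm_eq_abs, abs_neg, abs_of_pos hr] at hBC
  have hxball : ∀ x ∈ Set.Icc (-r) (0 : ℝ), ‖(x : ℂ)‖ ≤ r := fun x hx => by
    rw [Complex.norm_real, Real.norm_eq_abs, abs_le]
    exact ⟨hx.1, hx.2.trans hr.le⟩
  have hSim : ∀ ρ ∈ S, ρ.im ≠ 0 := fun ρ hρ h =>
    hre ρ (hsub ((hSmem ρ).1 hρ).1) h ((hSmem ρ).1 hρ).2
  have hslit1 : ∀ ρ ∈ S, ∀ x : ℝ, (x : ℂ) - ρ ∈ Complex.slitPlane := fun ρ hρ x =>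
    Complex.mem_slitPlane_iff.2 (Or.inr (by simpa using hSim ρ hρ))
  have hslit2 : ∀ ρ ∈ S, ∀ x ∈ Set.Icc (-r) (0 : ℝ), q ρ x ∈ Complex.slitPlane := fun ρ hρ x hx =>
    Complex.mem_slitPlane_iff.2 (Or.inl (hqre ρ hρ x ((hxball x hx).trans_lt (hr₁.trans hR))))
  -- This is a logarithm of f = ∏ ((z-ρ)/q)^n · g2. Principal branches suffice: z - ρ is never real
  -- on the radius because no zero is real, and q has positive real part.
  refine ⟨fun x => ∑ ρ ∈ S, (n ρ : ℂ) * (Complex.log (x - ρ) - Complex.log (q ρ x)) + H x,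
    ?_, ?_, ?_⟩
  · refine (continuousOn_finsetSum _ fun ρ hρ => continuousOn_const.mul (ContinuousOn.sub ?_ ?_)).add
      (hH.continuousOn.comp Complex.continuous_ofReal.continuousOn fun x hx => ?_)
    · exact (Complex.continuous_ofReal.sub continuous_const).continuousOn.clog
        fun x _ => hslit1 ρ hρ x
    · exact ((hqd ρ).continuous.comp Complex.continuous_ofReal).continuousOn.clog
        fun x hx => hslit2 ρ hρ x hx
    · exact mem_ball_zero_iff.2 ((hxball x hx).trans_lt hr₁)
  · intro x hx
    have hxb : (x : ℂ) ∈ Metric.ball (0 : ℂ) r₁ := mem_ball_zero_iff.2 ((hxball x hx).trans_lt hr₁)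
    rw [Complex.exp_add, hHexp _ hxb, Complex.exp_sum, hfg]
    simp only [hg2]
    rw [← mul_assoc, ← Finset.prod_mul_distrib]
    congr 1
    refine Finset.prod_congr rfl fun ρ hρ => ?_
    rw [Complex.exp_nat_mul, Complex.exp_sub, Complex.exp_log
      (Complex.slitPlane_ne_zero (hslit1 ρ hρ x)), Complex.exp_log
      (Complex.slitPlane_ne_zero (hslit2 ρ hρ x hx)), div_pow,
      div_mul_cancel₀ _ (pow_ne_zero _ (Complex.slitPlane_ne_zero (hslit2 ρ hρ x hx)))]
  · have hterm : ∀ ρ ∈ S, |((n ρ : ℂ) * (Complex.log (((-r : ℝ) : ℂ) - ρ) -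
        Complex.log (q ρ ((-r : ℝ) : ℂ)))).im - ((n ρ : ℂ) * (Complex.log (((0 : ℝ) : ℂ) - ρ) -
        Complex.log (q ρ ((0 : ℝ) : ℂ)))).im| ≤ n ρ * (4 * Real.pi) := by
      intro ρ _
      have him : ∀ w : ℂ, ((n ρ : ℂ) * w).im = n ρ * w.im := fun w => by
        simp
      rw [him, him, ← mul_sub, abs_mul, Nat.abs_cast, Complex.sub_im, Complex.sub_im]
      gcongr
      have h1 := abs_le.1 (abs_im_log_le (((-r : ℝ) : ℂ) - ρ))
      have h2 := abs_le.1 (abs_im_log_le (q ρ ((-r : ℝ) : ℂ)))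
      have h3 := abs_le.1 (abs_im_log_le (((0 : ℝ) : ℂ) - ρ))
      have h4 := abs_le.1 (abs_im_log_le (q ρ ((0 : ℝ) : ℂ)))
      rw [abs_le]
      constructor <;> linarith [h1.1, h1.2, h2.1, h2.2, h3.1, h3.2, h4.1, h4.2]
    have hsum := (Finset.abs_sum_le_sum_abs _ _).trans (Finset.sum_le_sum hterm)
    rw [← Finset.sum_mul, ← Nat.cast_sum, Finset.sum_sub_distrib] at hsum
    have hHim : |(H ((-r : ℝ) : ℂ)).im - (H ((0 : ℝ) : ℂ)).im| ≤ 2 * (K + 1) * r / (r₁ - r) := by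
      rw [← Complex.sub_im, Complex.ofReal_zero]
      exact (Complex.abs_im_le_norm _).trans hBC
    simp only [Complex.add_im, Complex.im_sum]
    have hNK' : (N : ℝ) * (4 * Real.pi) ≤ 4 * Real.pi / Real.log (R / r₁) * (K + 1) := by
      calc (N : ℝ) * (4 * Real.pi) ≤ K / Real.log (R / r₁) * (4 * Real.pi) := by gcongr
        _ = 4 * Real.pi / Real.log (R / r₁) * K := by ring
        _ ≤ _ := by
          gcongr
          linarith
    have hfinal : 2 * (K + 1) * r / (r₁ - r) = 2 * r / (r₁ - r) * (K + 1) := by ring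
    rw [add_mul, ← hfinal]
    refine le_trans ?_ (add_le_add hNK' hHim)
    refine le_trans (le_of_eq ?_) ((abs_add_le _ _).trans (add_le_add_left hsum _))
    congr 1
    ring

end EReversed

namespace EReversed

/-! ### A continuous logarithm of the Gamma function -/

/-- The derivative -z/(1+z) has norm at most |z|, because |1+z| ≥ 1 when `Re z ≥ 0`. -/
lemma norm_log_one_add_sub_self_le_sq {w : ℂ} (hw : 0 ≤ w.re) :
    ‖Complex.log (1 + w) - w‖ ≤ ‖w‖ ^ 2 := by
  set D : Set ℂ := {z | 0 ≤ z.re} ∩ Metric.closedBall 0 ‖w‖ with hD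
  have hconv : Convex ℝ D := (convex_halfSpace_re_ge 0).inter (convex_closedBall _ _)
  have hslit : ∀ z ∈ D, 1 + z ∈ Complex.slitPlane := fun z hz =>
    Complex.mem_slitPlane_iff.2 (Or.inl (by
      have : 0 ≤ z.re := hz.1
      simp only [Complex.add_re, Complex.one_re]; linarith))
  have hder : ∀ z ∈ D, HasDerivWithinAt (fun z => Complex.log (1 + z) - z) (1 / (1 + z) - 1) D z :=
    fun z hz => ((((hasDerivAt_id z).const_add 1).clog (hslit z hz)).sub
      (hasDerivAt_id z)).hasDerivWithinAt
  have hbound : ∀ z ∈ D, ‖1 / (1 + z) - 1‖ ≤ ‖w‖ := by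
    intro z hz
    have h1 := Complex.slitPlane_ne_zero (hslit z hz)
    have h2 : 1 / (1 + z) - 1 = -z / (1 + z) := by field_simp; ring
    have h3 : 1 ≤ ‖1 + z‖ := by
      have := Complex.re_le_norm (1 + z)
      have h4 : 0 ≤ z.re := hz.1
      simp only [Complex.add_re, Complex.one_re] at this
      linarith
    rw [h2, norm_div, norm_neg]
    exact (div_le_self (norm_nonneg _) h3).trans (by simpa using hz.2)
  have := hconv.norm_image_sub_le_of_norm_hasDerivWithin_le hder hbound
    (x := 0) (y := w) ⟨by simp, by simp⟩ ⟨hw, by simp⟩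
  simpa [sq] using this

/-- The terms of the Euler product of the Gamma function, in logarithmic form. -/
noncomputable def logGammaTerm (k : ℕ) (s : ℂ) : ℂ :=
  s * Complex.log (1 + 1 / ((k : ℂ) + 1)) - Complex.log (1 + s / ((k : ℂ) + 1))

/-- A logarithm of the Gamma function in the right half-plane. -/
noncomputable def logGamma (s : ℂ) : ℂ := -Complex.log s + ∑' k : ℕ, logGammaTerm k s

lemma norm_natCast_succ (k : ℕ) : ‖(k : ℂ) + 1‖ = (k : ℝ) + 1 := by
  have : (k : ℂ) + 1 = ((k + 1 : ℕ) : ℂ) := by push_cast; rfl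
  rw [this, Complex.norm_natCast]; push_cast; rfl

lemma re_div_natCast_succ (s : ℂ) (k : ℕ) : (s / ((k : ℂ) + 1)).re = s.re / ((k : ℝ) + 1) := by
  have : (k : ℂ) + 1 = (((k : ℝ) + 1 : ℝ) : ℂ) := by push_cast; rfl
  rw [this, Complex.div_ofReal_re]

lemma norm_logGammaTerm_le {s : ℂ} (hs : 0 ≤ s.re) (k : ℕ) :
    ‖logGammaTerm k s‖ ≤ (‖s‖ + ‖s‖ ^ 2) * (1 / ((k : ℝ) + 1) ^ 2) := by
  have hk : (0 : ℝ) < (k : ℝ) + 1 := by positivity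
  have h1 := norm_log_one_add_sub_self_le_sq (w := 1 / ((k : ℂ) + 1)) (by
    rw [re_div_natCast_succ]; simp; positivity)
  have h2 := norm_log_one_add_sub_self_le_sq (w := s / ((k : ℂ) + 1)) (by
    rw [re_div_natCast_succ]; positivity)
  rw [norm_div, norm_natCast_succ] at h1 h2
  rw [norm_one, div_pow, one_pow] at h1
  rw [div_pow] at h2
  have h3 : logGammaTerm k s = s * (Complex.log (1 + 1 / ((k : ℂ) + 1)) - 1 / ((k : ℂ) + 1)) -
      (Complex.log (1 + s / ((k : ℂ) + 1)) - s / ((k : ℂ) + 1)) := by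
    rw [logGammaTerm]; ring
  rw [h3]
  refine (norm_sub_le _ _).trans ?_
  rw [norm_mul, add_mul]
  refine add_le_add (by gcongr) (h2.trans (le_of_eq (by ring)))

lemma summable_one_div_succ_sq : Summable fun k : ℕ => 1 / ((k : ℝ) + 1) ^ 2 := by
  have := (summable_nat_add_iff 1).2 (Real.summable_one_div_nat_pow.2 one_lt_two)
  simpa using this

lemma summable_logGammaTerm {s : ℂ} (hs : 0 ≤ s.re) : Summable fun k => logGammaTerm k s :=
  .of_norm_bounded (summable_one_div_succ_sq.mul_left _) (norm_logGammaTerm_le hs)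

lemma one_add_div_mem_slitPlane {s : ℂ} (hs : 0 ≤ s.re) (k : ℕ) :
    1 + s / ((k : ℂ) + 1) ∈ Complex.slitPlane :=
  Complex.mem_slitPlane_iff.2 (Or.inl (by
    rw [Complex.add_re, re_div_natCast_succ, Complex.one_re]; positivity))

lemma continuousAt_logGamma {s : ℂ} (hs : 0 < s.re) : ContinuousAt logGamma s := by
  set U : Set ℂ := {z | 0 < z.re} ∩ Metric.ball 0 (‖s‖ + 1) with hU
  have hUo : IsOpen U := isOpen_re_pos.inter Metric.isOpen_ball
  have hsU : s ∈ U := ⟨hs, by simp⟩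
  have hc : ContinuousOn (fun s => ∑' k : ℕ, logGammaTerm k s) U := by
    refine continuousOn_tsum (u := fun k : ℕ => ((‖s‖ + 1) + (‖s‖ + 1) ^ 2) *
      (1 / ((k : ℝ) + 1) ^ 2)) (fun k => ?_) (summable_one_div_succ_sq.mul_left _) fun k z hz => ?_
    · refine (continuousOn_id.mul continuousOn_const).sub (ContinuousOn.clog ?_ fun z hz =>
        one_add_div_mem_slitPlane (le_of_lt hz.1) k)
      exact (continuous_const.add (continuous_id.div_const _)).continuousOn
    · refine (norm_logGammaTerm_le (le_of_lt hz.1) k).trans ?_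
      have : ‖z‖ ≤ ‖s‖ + 1 := (mem_ball_zero_iff.1 hz.2).le
      gcongr
  exact (continuousAt_clog (Complex.mem_slitPlane_iff.2 (Or.inl hs))).neg.add
    (hc.continuousAt (hUo.mem_nhds hsU))

lemma exp_neg_log_add_sum_logGammaTerm {s : ℂ} (hs : 0 < s.re) (n : ℕ) :
    Complex.exp (-Complex.log s + ∑ k ∈ Finset.range n, logGammaTerm k s) =
      ((n + 1 : ℕ) : ℂ) ^ s * n.factorial / ∏ j ∈ Finset.range (n + 1), (s + j) := by
  have hs0 : s ≠ 0 := by rintro rfl; simp at hs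
  induction n with
  | zero => simp [Complex.exp_neg, Complex.exp_log hs0]
  | succ n ih =>
    have hn : (n : ℂ) + 1 ≠ 0 := by exact_mod_cast n.succ_ne_zero
    have h1 := Complex.slitPlane_ne_zero (one_add_div_mem_slitPlane hs.le n)
    have h2 := Complex.slitPlane_ne_zero (one_add_div_mem_slitPlane (s := 1) (by simp) n)
    have hprod : ∏ j ∈ Finset.range (n + 1), (s + j) ≠ 0 := Finset.prod_ne_zero_iff.2 fun j _ h => by
      have := congrArg Complex.re h
      simp at this
      have hj : (0 : ℝ) ≤ j := j.cast_nonneg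
      linarith
    rw [Finset.sum_range_succ, ← add_assoc, Complex.exp_add, ih, logGammaTerm, Complex.exp_sub,
      Complex.exp_log h1, mul_comm s, ← Complex.cpow_def_of_ne_zero h2,
      Finset.prod_range_succ _ (n + 1), Nat.factorial_succ]
    have h3 : (((n + 1 + 1 : ℕ) : ℂ)) ^ s =
        ((n + 1 : ℕ) : ℂ) ^ s * (1 + 1 / ((n : ℂ) + 1)) ^ s := by
      have h4 : (1 : ℂ) + 1 / ((n : ℂ) + 1) = ((1 + 1 / ((n : ℝ) + 1) : ℝ) : ℂ) := by push_cast; rfl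
      have h5 := Complex.mul_cpow_ofReal_nonneg (a := ((n + 1 : ℕ) : ℝ))
        (b := 1 + 1 / ((n : ℝ) + 1)) (by positivity) (by positivity) s
      rw [h4, ← Complex.ofReal_natCast (n + 1), ← h5, ← Complex.ofReal_mul]
      congr 1
      rw [← Complex.ofReal_natCast, Complex.ofReal_inj]
      push_cast
      field_simp
    rw [h3]
    have h6 : s + ((n + 1 : ℕ) : ℂ) ≠ 0 := by
      intro h
      apply h1
      push_cast at h
      field_simp
      linear_combination h
    have h7 : 1 + s / ((n : ℂ) + 1) = (s + ((n + 1 : ℕ) : ℂ)) / ((n : ℂ) + 1) := by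
      push_cast; field_simp; ring
    rw [h7]
    push_cast at h6 ⊢
    field_simp

lemma exp_logGamma {s : ℂ} (hs : 0 < s.re) : Complex.exp (logGamma s) = Complex.Gamma s := by
  have h1 : Tendsto (fun n : ℕ => Complex.exp (-Complex.log s +
      ∑ k ∈ Finset.range n, logGammaTerm k s)) atTop (𝓝 (Complex.exp (logGamma s))) :=
    (Complex.continuous_exp.tendsto _).comp
      ((summable_logGammaTerm hs.le).hasSum.tendsto_sum_nat.const_add _)
  -- The partial products have one factor fewer than `GammaSeq` at n + 1; this ratio, tending to 1,
  -- is the discrepancy.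
  have h2 : Tendsto (fun n : ℕ => ((n + 1 : ℕ) : ℂ) / (((n + 1 : ℕ) : ℂ) + s)) atTop (𝓝 1) :=
    (tendsto_natCast_div_add_atTop s).comp (tendsto_add_atTop_nat 1)
  have h3 := (Complex.GammaSeq_tendsto_Gamma s).comp (tendsto_add_atTop_nat 1)
  have h4 := h1.mul h2
  rw [mul_one] at h4
  refine tendsto_nhds_unique h4 (h3.congr fun n => ?_)
  rw [Function.comp_apply, exp_neg_log_add_sum_logGammaTerm hs, Complex.GammaSeq,
    Finset.prod_range_succ _ (n + 1), Nat.factorial_succ]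
  have hprod : ∏ j ∈ Finset.range (n + 1), (s + j) ≠ 0 := Finset.prod_ne_zero_iff.2 fun j _ h => by
    have := congrArg Complex.re h
    simp at this
    have hj : (0 : ℝ) ≤ j := j.cast_nonneg
    linarith
  have h6 : s + ((n + 1 : ℕ) : ℂ) ≠ 0 := fun h => by
    have := congrArg Complex.re h
    simp at this
    have hj : (0 : ℝ) ≤ n := n.cast_nonneg
    linarith
  have h7 : ((n + 1 : ℕ) : ℂ) + s ≠ 0 := by rwa [add_comm]
  push_cast at h6 h7 ⊢
  field_simp
  ring

/-! ### The argument of Gamma on the critical line -/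

/-- An antiderivative of `x ↦ arctan (T / x)`. -/
noncomputable def arctanPrimitive (T x : ℝ) : ℝ :=
  x * Real.arctan (T / x) + T / 2 * Real.log (x ^ 2 + T ^ 2)

lemma hasDerivAt_arctanPrimitive (T : ℝ) {x : ℝ} (hx : 0 < x) :
    HasDerivAt (arctanPrimitive T) (Real.arctan (T / x)) x := by
  have h1 : HasDerivAt (fun x : ℝ => T / x) (-T / x ^ 2) x := by
    simpa [div_eq_mul_inv, mul_comm] using (hasDerivAt_inv hx.ne').const_mul T
  have h2 : HasDerivAt (fun x : ℝ => x ^ 2 + T ^ 2) (2 * x) x := by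
    simpa using (hasDerivAt_pow 2 x).add_const (T ^ 2)
  have hpos : 0 < x ^ 2 + T ^ 2 := by positivity
  have h3 := ((hasDerivAt_id x).mul h1.arctan).add ((h2.log hpos.ne').const_mul (T / 2))
  refine h3.congr_deriv ?_
  simp only [id]
  have hpos' : x ^ 2 + T ^ 2 ≠ 0 := hpos.ne'
  have : 1 + (T / x) ^ 2 = (x ^ 2 + T ^ 2) / x ^ 2 := by field_simp
  rw [this]
  field_simp
  ring

lemma arctanPrimitive_succ_sub {T x : ℝ} (hT : 0 < T) (hx : 0 < x) :
    Real.arctan (T / (x + 1)) ≤ arctanPrimitive T (x + 1) - arctanPrimitive T x ∧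
      arctanPrimitive T (x + 1) - arctanPrimitive T x ≤ Real.arctan (T / x) := by
  obtain ⟨c, hc, hcs⟩ := exists_hasDerivAt_eq_slope (arctanPrimitive T)
    (fun x => Real.arctan (T / x)) (lt_add_one x)
    (fun y hy => (hasDerivAt_arctanPrimitive T (hx.trans_le hy.1)).continuousAt.continuousWithinAt)
    (fun y hy => hasDerivAt_arctanPrimitive T (hx.trans hy.1))
  rw [add_sub_cancel_left, div_one] at hcs
  rw [← hcs]
  have hc0 : 0 < c := hx.trans hc.1
  exact ⟨Real.arctan_strictMono.monotone (div_le_div_of_nonneg_left hT.le hc0 hc.2.le),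
    Real.arctan_strictMono.monotone (div_le_div_of_nonneg_left hT.le hx hc.1.le)⟩

/-- Integral comparison for the decreasing function x ↦ arctan(T/x); the defect is at most the first
term, which is below π/2. -/
lemma sum_arctan_bounds {T : ℝ} (hT : 0 < T) (n : ℕ) :
    arctanPrimitive T (n + 3 / 2) - arctanPrimitive T (1 / 2) ≤
        ∑ k ∈ Finset.range (n + 1), Real.arctan (T / (k + 1 / 2)) ∧
      ∑ k ∈ Finset.range (n + 1), Real.arctan (T / (k + 1 / 2)) ≤
        arctanPrimitive T (n + 3 / 2) - arctanPrimitive T (1 / 2) + Real.pi / 2 := by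
  constructor
  · induction n with
    | zero =>
      have := (arctanPrimitive_succ_sub hT (x := 1 / 2) (by norm_num)).2
      norm_num at this ⊢
      linarith
    | succ n ih =>
      have := (arctanPrimitive_succ_sub hT (x := n + 3 / 2) (by positivity)).2
      rw [Finset.sum_range_succ]
      push_cast
      rw [show (n : ℝ) + 1 + 3 / 2 = n + 3 / 2 + 1 by ring,
        show (n : ℝ) + 1 + 1 / 2 = n + 3 / 2 by ring]
      linarith
  -- Above, the sum without its first term is compared with the integral up to n + 1/2 only; the
  -- induction runs on this sharper bound.
  · suffices h : ∑ k ∈ Finset.range (n + 1), Real.arctan (T / (k + 1 / 2)) ≤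
        arctanPrimitive T (n + 1 / 2) - arctanPrimitive T (1 / 2) + Real.pi / 2 by
      have h1 := (arctanPrimitive_succ_sub hT (x := n + 1 / 2) (by positivity)).1
      have h2 : 0 ≤ Real.arctan (T / ((n : ℝ) + 1 / 2 + 1)) := Real.arctan_nonneg.2 (by positivity)
      rw [show (n : ℝ) + 1 / 2 + 1 = n + 3 / 2 by ring] at h1 h2
      linarith
    induction n with
    | zero =>
      have := Real.arctan_lt_pi_div_two (T / (1 / 2))
      simpa using this.le
    | succ n ih =>
      have := (arctanPrimitive_succ_sub hT (x := n + 1 / 2) (by positivity)).1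
      rw [Finset.sum_range_succ]
      push_cast
      rw [show (n : ℝ) + 1 + 1 / 2 = n + 1 / 2 + 1 by ring]
      linarith

lemma tendsto_mul_arctan_div {T : ℝ} (hT : 0 < T) :
    Tendsto (fun n : ℕ => ((n : ℝ) + 3 / 2) * Real.arctan (T / (n + 3 / 2))) atTop (𝓝 T) := by
  have hx : Tendsto (fun n : ℕ => (n : ℝ) + 3 / 2) atTop atTop :=
    tendsto_atTop_add_const_right _ _ tendsto_natCast_atTop_atTop
  have h0 : Tendsto (fun n : ℕ => T / ((n : ℝ) + 3 / 2)) atTop (𝓝[≠] 0) := by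
    refine tendsto_nhdsWithin_iff.2 ⟨hx.const_div_atTop T, Eventually.of_forall fun n => ?_⟩
    have : 0 < T / ((n : ℝ) + 3 / 2) := by positivity
    exact this.ne'
  have h1 := (hasDerivAt_iff_tendsto_slope.1 (Real.hasDerivAt_arctan 0)).comp h0
  have h2 := h1.const_mul T
  norm_num at h2
  refine h2.congr fun n => ?_
  simp only [slope_def_field, Real.arctan_zero, sub_zero]
  have : (n : ℝ) + 3 / 2 ≠ 0 := by positivity
  field_simp

lemma tendsto_log_sub_arctanPrimitive {T : ℝ} (hT : 0 < T) :
    Tendsto (fun n : ℕ => T * Real.log (n + 1) - arctanPrimitive T (n + 3 / 2)) atTop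
      (𝓝 (-T)) := by
  have hn : Tendsto (fun n : ℕ => 1 / ((n : ℝ) + 1)) atTop (𝓝 0) :=
    tendsto_one_div_add_atTop_nhds_zero_nat
  have h1 : Tendsto (fun n : ℕ => (1 + 1 / 2 * (1 / ((n : ℝ) + 1))) ^ 2 +
      (T * (1 / ((n : ℝ) + 1))) ^ 2) atTop (𝓝 ((1 + 1 / 2 * 0) ^ 2 + (T * 0) ^ 2)) :=
    (((hn.const_mul _).const_add 1).pow 2).add ((hn.const_mul T).pow 2)
  rw [show ((1 : ℝ) + 1 / 2 * 0) ^ 2 + (T * 0) ^ 2 = 1 by ring] at h1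
  have h2 := ((Real.continuousAt_log one_ne_zero).tendsto.comp h1).const_mul (T / 2)
  rw [Real.log_one, mul_zero] at h2
  have h3 := ((tendsto_mul_arctan_div hT).add h2).neg
  rw [add_zero] at h3
  refine h3.congr fun n => ?_
  have hn1 : (0 : ℝ) < (n : ℝ) + 1 := by positivity
  have h4 : (1 + 1 / 2 * (1 / ((n : ℝ) + 1))) ^ 2 + (T * (1 / ((n : ℝ) + 1))) ^ 2 =
      (((n : ℝ) + 3 / 2) ^ 2 + T ^ 2) / ((n : ℝ) + 1) ^ 2 := by
    field_simp; ring
  rw [Function.comp_apply, h4, Real.log_div (by positivity) (by positivity), Real.log_pow,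
    arctanPrimitive]
  push_cast
  ring

lemma arg_eq_arctan_of_re_pos {z : ℂ} (hz : 0 < z.re) : z.arg = Real.arctan (z.im / z.re) := by
  have h := Complex.abs_arg_lt_pi_div_two_iff.2 (Or.inl hz)
  rw [abs_lt] at h
  rw [← Complex.tan_arg, Real.arctan_tan h.1 h.2]

/-- The logarithms log(1+1/(k+1)) telescope, and the initial -log s supplies the arctangent with k =
0, whence `range (n + 1)`. -/
lemma im_neg_log_add_sum_logGammaTerm (T : ℝ) (n : ℕ) :
    (-Complex.log (1 / 2 + T * Complex.I) +
      ∑ k ∈ Finset.range n, logGammaTerm k (1 / 2 + T * Complex.I)).im =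
      T * Real.log (n + 1) - ∑ k ∈ Finset.range (n + 1), Real.arctan (T / (k + 1 / 2)) := by
  induction n with
  | zero =>
    rw [Finset.sum_range_zero, add_zero, Complex.neg_im, Complex.log_im,
      arg_eq_arctan_of_re_pos (by simp)]
    simp
  | succ n ih =>
    have hn : (0 : ℝ) < (n : ℝ) + 1 := by positivity
    have hL : Complex.log (1 + 1 / ((n : ℂ) + 1)) =
        ((Real.log (1 + 1 / ((n : ℝ) + 1)) : ℝ) : ℂ) := by
      rw [Complex.ofReal_log (by positivity)]; push_cast; rfl
    have hdiv : (1 : ℂ) + (1 / 2 + T * Complex.I) / ((n : ℂ) + 1) =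
        ⟨(n + 3 / 2) / (n + 1), T / (n + 1)⟩ := by
      have : (n : ℂ) + 1 = (((n : ℝ) + 1 : ℝ) : ℂ) := by push_cast; rfl
      rw [this]
      apply Complex.ext
      · rw [Complex.add_re, Complex.div_ofReal_re]
        simp
        field_simp
        ring
      · rw [Complex.add_im, Complex.div_ofReal_im]
        simp
    have hterm : (logGammaTerm n (1 / 2 + T * Complex.I)).im =
        T * Real.log (1 + 1 / ((n : ℝ) + 1)) - Real.arctan (T / ((n + 1 : ℕ) + 1 / 2)) := by
      rw [logGammaTerm, Complex.sub_im, hL, Complex.log_im, hdiv,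
        arg_eq_arctan_of_re_pos (by simp only; positivity)]
      rw [Complex.mul_im, Complex.ofReal_re, Complex.ofReal_im]
      congr 1
      · simp
      · congr 1
        push_cast
        have : (n : ℝ) + 3 / 2 ≠ 0 := by positivity
        have : (n : ℝ) + 1 + 1 / 2 ≠ 0 := by positivity
        field_simp
        ring
    rw [Finset.sum_range_succ, ← add_assoc, Complex.add_im, ih, hterm,
      Finset.sum_range_succ _ (n + 1)]
    have hlog : Real.log (((n + 1 : ℕ) : ℝ) + 1) =
        Real.log ((n : ℝ) + 1) + Real.log (1 + 1 / ((n : ℝ) + 1)) := by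
      rw [← Real.log_mul (by positivity) (by positivity)]
      congr 1
      push_cast
      field_simp
    rw [hlog]
    ring

/-- Stirling's formula for the argument on σ = 1/2. With F = `arctanPrimitive T`, the limit lies
between F(1/2) - T - π/2 and F(1/2) - T, while F(1/2) exceeds T log T by at most π/4 + 1/8. -/
lemma abs_im_logGamma_sub_le {T : ℝ} (hT : 1 ≤ T) :
    |(logGamma (1 / 2 + T * Complex.I)).im - (T * Real.log T - T)| ≤ 3 := by
  have hT0 : 0 < T := by linarith
  have hre : 0 ≤ ((1 : ℂ) / 2 + T * Complex.I).re := by simp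
  have h1 : Tendsto (fun n : ℕ => T * Real.log (n + 1) -
      ∑ k ∈ Finset.range (n + 1), Real.arctan (T / (k + 1 / 2))) atTop
      (𝓝 (logGamma (1 / 2 + T * Complex.I)).im) := by
    refine ((Complex.continuous_im.tendsto _).comp
      ((summable_logGammaTerm hre).hasSum.tendsto_sum_nat.const_add _)).congr fun n => ?_
    exact im_neg_log_add_sum_logGammaTerm T n
  have h2 := (tendsto_log_sub_arctanPrimitive hT0).add_const (arctanPrimitive T (1 / 2))
  have hup : (logGamma (1 / 2 + T * Complex.I)).im ≤ -T + arctanPrimitive T (1 / 2) :=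
    le_of_tendsto_of_tendsto' h1 h2 fun n => by linarith [(sum_arctan_bounds hT0 n).1]
  have hlo : -T + arctanPrimitive T (1 / 2) - Real.pi / 2 ≤
      (logGamma (1 / 2 + T * Complex.I)).im :=
    le_of_tendsto_of_tendsto' (h2.sub_const (Real.pi / 2)) h1 fun n => by
      linarith [(sum_arctan_bounds hT0 n).2]
  have hlog : Real.log ((1 / 2 : ℝ) ^ 2 + T ^ 2) =
      2 * Real.log T + Real.log (1 + 1 / (4 * T ^ 2)) := by
    rw [show (1 / 2 : ℝ) ^ 2 + T ^ 2 = T ^ 2 * (1 + 1 / (4 * T ^ 2)) by field_simp; ring,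
      Real.log_mul (by positivity) (by positivity), Real.log_pow]
    push_cast; ring
  have hsmall0 : 0 ≤ Real.log (1 + 1 / (4 * T ^ 2)) := Real.log_nonneg (by
    have : (0 : ℝ) ≤ 1 / (4 * T ^ 2) := by positivity
    linarith)
  have hsmall : T / 2 * Real.log (1 + 1 / (4 * T ^ 2)) ≤ 1 / 8 := by
    have h3 : Real.log (1 + 1 / (4 * T ^ 2)) ≤ 1 / (4 * T ^ 2) := by
      have := Real.log_le_sub_one_of_pos (x := 1 + 1 / (4 * T ^ 2)) (by positivity)
      linarith
    calc T / 2 * Real.log (1 + 1 / (4 * T ^ 2)) ≤ T / 2 * (1 / (4 * T ^ 2)) := by gcongr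
      _ = 1 / (8 * T) := by field_simp; ring
      _ ≤ 1 / 8 := by
        rw [div_le_div_iff₀ (by positivity) (by norm_num)]
        linarith
  have hsmall' : 0 ≤ T / 2 * Real.log (1 + 1 / (4 * T ^ 2)) := by positivity
  have ha0 : 0 ≤ Real.arctan (T / (1 / 2)) := Real.arctan_nonneg.2 (by positivity)
  have ha1 := Real.arctan_lt_pi_div_two (T / (1 / 2))
  have hpi := Real.pi_lt_d2
  rw [arctanPrimitive, hlog] at hup hlo
  rw [abs_le]
  constructor <;> nlinarith

end EReversed

namespace EReversed

/-! ### Zeros of `E`: finiteness and symmetry of multiplicities -/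

lemma analyticOnNhd_E : AnalyticOnNhd ℂ E Set.univ :=
  differentiable_E.differentiableOn.analyticOnNhd isOpen_univ

lemma E_two_ne_zero : E 2 ≠ 0 := E_ne_zero_of_one_lt_re (by norm_num)

lemma analyticOrderAt_E_ne_top (z : ℂ) : analyticOrderAt E z ≠ ⊤ :=
  analyticOrderAt_ne_top_of_ne_zero analyticOnNhd_E isPreconnected_univ (Set.mem_univ 2)
    E_two_ne_zero (Set.mem_univ z)

lemma finite_zeros_E {K : Set ℂ} (hK : IsCompact K) : {z | z ∈ K ∧ E z = 0}.Finite :=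
  finite_zeros_of_isCompact analyticOnNhd_E isPreconnected_univ (Set.mem_univ 2) E_two_ne_zero hK
    (Set.subset_univ K)

lemma norm_sub_half_le {s : ℂ} (h0 : 0 ≤ s.re) (h1 : s.re ≤ 1) (h2 : 0 ≤ s.im) :
    ‖s - 1 / 2‖ ≤ s.im + 1 / 2 := by
  refine (Complex.norm_le_abs_re_add_abs_im _).trans ?_
  have h3 : (s - 1 / 2).re = s.re - 1 / 2 := by simp
  have h4 : (s - 1 / 2).im = s.im := by simp
  rw [h3, h4, abs_of_nonneg h2, add_comm]
  have : |s.re - 1 / 2| ≤ 1 / 2 := abs_le.2 ⟨by linarith, by linarith⟩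
  linarith

lemma finite_zerosUpTo (T : ℝ) : (zerosUpTo T).Finite := by
  refine (finite_zeros_E (isCompact_closedBall (1 / 2 : ℂ) (T + 1 / 2))).subset ?_
  rintro s ⟨hs, h0, h1, h2, h3⟩
  refine ⟨?_, hs⟩
  rw [Metric.mem_closedBall, dist_eq_norm]
  linarith [norm_sub_half_le h0 h1 h2]

/-- Reflect the local factorisation (z-ρ)^n g(z) by z ↦ 1 - z̄ and conjugate; the power acquires the
sign (-1)^n. -/
lemma analyticOrderNatAt_E_one_sub_conj (ρ : ℂ) :
    analyticOrderNatAt E (1 - (starRingEnd ℂ) ρ) = analyticOrderNatAt E ρ := by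
  obtain ⟨g, hg, hg0, hgE⟩ := ((analyticOnNhd_E ρ trivial).analyticOrderNatAt_eq_iff
    (analyticOrderAt_E_ne_top ρ)).1 rfl
  set n := analyticOrderNatAt E ρ
  set ρ' := 1 - (starRingEnd ℂ) ρ with hρ'
  have hρ : 1 - (starRingEnd ℂ) ρ' = ρ := by simp [hρ']
  have hcont : Tendsto (fun z : ℂ => 1 - (starRingEnd ℂ) z) (𝓝 ρ') (𝓝 ρ) := by
    have : Continuous fun z : ℂ => 1 - (starRingEnd ℂ) z :=
      continuous_const.sub Complex.continuous_conj
    simpa [hρ] using this.tendsto ρ'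
  refine ((analyticOnNhd_E ρ' trivial).analyticOrderNatAt_eq_iff
    (analyticOrderAt_E_ne_top ρ')).2 ⟨fun z => (-1) ^ n *
      (starRingEnd ℂ) (g (1 - (starRingEnd ℂ) z)), ?_, ?_, ?_⟩
  · refine analyticAt_const.mul (Complex.analyticAt_iff_eventually_differentiableAt.2 ?_)
    filter_upwards [hcont.eventually (Complex.analyticAt_iff_eventually_differentiableAt.1 hg)] with z hz
    have h1 : DifferentiableAt ℂ (fun w => g (1 - w)) ((starRingEnd ℂ) z) :=
      hz.comp ((starRingEnd ℂ) z) (differentiableAt_id.const_sub 1)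
    have h2 := h1.conj_conj
    rw [Complex.conj_conj] at h2
    exact h2
  · simp only [hρ]
    exact mul_ne_zero (pow_ne_zero _ (by norm_num)) ((map_ne_zero _).2 hg0)
  · filter_upwards [hcont.eventually hgE] with z hz
    have h1 := E_one_sub_conj z
    rw [hz] at h1
    have h2 := congrArg (starRingEnd ℂ) h1
    rw [Complex.conj_conj, smul_eq_mul, map_mul, map_pow, map_sub, map_sub, Complex.conj_conj,
      map_one] at h2
    rw [← h2, smul_eq_mul, ← mul_assoc, ← mul_pow]
    congr 2
    rw [hρ']
    ring

/-! ### A logarithm of `E` along the boundary of a rectangle -/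

lemma arg_add_arg_neg_conj_of_im_pos {w : ℂ} (hw : 0 < w.im) :
    w.arg + (-(starRingEnd ℂ) w).arg = Real.pi := by
  have h1 : w.arg ≠ Real.pi := fun h => by
    rw [Complex.arg_eq_pi_iff] at h; linarith [h.2]
  rw [Complex.arg_neg_eq_arg_add_pi_of_im_neg (by simpa using hw), Complex.arg_conj, if_neg h1]
  ring

lemma arg_add_arg_neg_conj_of_im_neg {w : ℂ} (hw : w.im < 0) :
    w.arg + (-(starRingEnd ℂ) w).arg = -Real.pi := by
  have h1 : w.arg ≠ Real.pi := fun h => by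
    rw [Complex.arg_eq_pi_iff] at h; linarith [h.2]
  rw [Complex.arg_neg_eq_arg_sub_pi_of_im_pos (by simpa using hw), Complex.arg_conj, if_neg h1]
  ring

/-- For s on the critical line, s - ρ and s - (1-ρ̄) are mirror images in the imaginary axis, so
their arguments add up to ±π. Reindexing one of two copies of the sum by the symmetry forms these
pairs. -/
lemma two_mul_sum_arg {S : Finset ℂ} {n : ℂ → ℕ}
    (hS : ∀ ρ ∈ S, 1 - (starRingEnd ℂ) ρ ∈ S) (hn : ∀ ρ ∈ S, n (1 - (starRingEnd ℂ) ρ) = n ρ)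
    {t : ℝ} (ht : ∀ ρ ∈ S, ρ.im ≠ t) :
    2 * ∑ ρ ∈ S, (n ρ : ℝ) * (1 / 2 + t * Complex.I - ρ).arg =
      ∑ ρ ∈ S, (n ρ : ℝ) * (if ρ.im < t then Real.pi else -Real.pi) := by
  have hinv : ∀ ρ : ℂ, 1 - (starRingEnd ℂ) (1 - (starRingEnd ℂ) ρ) = ρ := fun ρ => by simp
  have hswap : ∑ ρ ∈ S, (n ρ : ℝ) * (1 / 2 + t * Complex.I - ρ).arg =
      ∑ ρ ∈ S, (n ρ : ℝ) * (-(starRingEnd ℂ) (1 / 2 + t * Complex.I - ρ)).arg := by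
    refine Finset.sum_nbij' (fun ρ => 1 - (starRingEnd ℂ) ρ) (fun ρ => 1 - (starRingEnd ℂ) ρ) hS hS
      (fun ρ _ => hinv ρ) (fun ρ _ => hinv ρ) fun ρ hρ => ?_
    rw [hn ρ hρ]
    congr 2
    simp only [map_sub, map_add, map_mul, map_div₀, map_one, Complex.conj_conj, Complex.conj_I,
      Complex.conj_ofReal, map_ofNat]
    ring
  rw [two_mul]
  nth_rw 2 [hswap]
  rw [← Finset.sum_add_distrib]
  refine Finset.sum_congr rfl fun ρ hρ => ?_
  rw [← mul_add]
  congr 1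
  have him : (1 / 2 + t * Complex.I - ρ).im = t - ρ.im := by simp
  split_ifs with h
  · exact arg_add_arg_neg_conj_of_im_pos (by rw [him]; linarith)
  · exact arg_add_arg_neg_conj_of_im_neg (by
      rw [him]; linarith [lt_of_le_of_ne (not_lt.1 h) (ht ρ hρ).symm])

/-- On the critical line E is real and conjugation multiplies the product over zeros by (-1)^N.
Cancelling that product is legitimate off finitely many heights, and continuity covers the rest. -/
lemma conj_eq_neg_one_pow_mul {S : Finset ℂ} {n : ℂ → ℕ}
    (hS : ∀ ρ ∈ S, 1 - (starRingEnd ℂ) ρ ∈ S) (hn : ∀ ρ ∈ S, n (1 - (starRingEnd ℂ) ρ) = n ρ)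
    {g : ℂ → ℂ} (hg : Continuous g) (hE : ∀ z, E z = (∏ ρ ∈ S, (z - ρ) ^ n ρ) * g z) (t : ℝ) :
    (starRingEnd ℂ) (g (1 / 2 + t * Complex.I)) =
      (-1) ^ (∑ ρ ∈ S, n ρ) * g (1 / 2 + t * Complex.I) := by
  have hinv : ∀ ρ : ℂ, 1 - (starRingEnd ℂ) (1 - (starRingEnd ℂ) ρ) = ρ := fun ρ => by simp
  have hline : Continuous fun t : ℝ => (1 / 2 + t * Complex.I : ℂ) := by fun_prop
  have hconj : ∀ t : ℝ, (starRingEnd ℂ) (1 / 2 + t * Complex.I : ℂ) = 1 - (1 / 2 + t * Complex.I) :=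
    fun t => by
      simp only [map_add, map_mul, map_div₀, map_one, Complex.conj_I, Complex.conj_ofReal,
        map_ofNat]
      ring
  set D : Set ℝ := ((S.image Complex.im : Finset ℝ) : Set ℝ)ᶜ with hD
  have hdense : Dense D := (Finset.countable_toSet _).dense_compl ℝ
  have hEq : Set.EqOn (fun t : ℝ => (starRingEnd ℂ) (g (1 / 2 + t * Complex.I)))
      (fun t : ℝ => (-1) ^ (∑ ρ ∈ S, n ρ) * g (1 / 2 + t * Complex.I)) D := by
    intro t ht
    set s : ℂ := 1 / 2 + t * Complex.I with hs
    have hP : ∏ ρ ∈ S, (s - ρ) ^ n ρ ≠ 0 := Finset.prod_ne_zero_iff.2 fun ρ hρ =>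
      pow_ne_zero _ fun h => ht (by
        rw [Finset.mem_coe, Finset.mem_image]
        refine ⟨ρ, hρ, ?_⟩
        rw [← sub_eq_zero.1 h, hs]; simp)
    have hPconj : (starRingEnd ℂ) (∏ ρ ∈ S, (s - ρ) ^ n ρ) =
        (-1) ^ (∑ ρ ∈ S, n ρ) * ∏ ρ ∈ S, (s - ρ) ^ n ρ := by
      rw [map_prod, ← Finset.prod_pow_eq_pow_sum, ← Finset.prod_mul_distrib]
      refine Finset.prod_nbij' (fun ρ => 1 - (starRingEnd ℂ) ρ) (fun ρ => 1 - (starRingEnd ℂ) ρ)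
        hS hS (fun ρ _ => hinv ρ) (fun ρ _ => hinv ρ) fun ρ hρ => ?_
      rw [hn ρ hρ, map_pow, ← mul_pow, map_sub, hs, hconj]
      congr 1
      ring
    have h1 : (starRingEnd ℂ) (E s) = E s := by
      rw [← E_conj, hs, hconj, E_one_sub]
    rw [hE s, map_mul, hPconj] at h1
    have hsq : ((-1 : ℂ) ^ (∑ ρ ∈ S, n ρ)) * (-1) ^ (∑ ρ ∈ S, n ρ) = 1 := by
      rw [← mul_pow]; norm_num
    have h2 : (∏ ρ ∈ S, (s - ρ) ^ n ρ) * ((-1) ^ (∑ ρ ∈ S, n ρ) * (starRingEnd ℂ) (g s)) =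
        (∏ ρ ∈ S, (s - ρ) ^ n ρ) * g s := by rw [← h1]; ring
    have h3 := mul_left_cancel₀ hP h2
    change (starRingEnd ℂ) (g s) = (-1) ^ (∑ ρ ∈ S, n ρ) * g s
    rw [← mul_right_inj' (pow_ne_zero (∑ ρ ∈ S, n ρ) (neg_ne_zero.2 (one_ne_zero (α := ℂ)))), h3,
      ← mul_assoc, hsq, one_mul]
  exact congrFun (Continuous.ext_on hdense (Complex.continuous_conj.comp (hg.comp hline))
    (continuous_const.mul (hg.comp hline)) hEq) t

/-- This replaces the argument principle: Λ = Σ n(ρ) log(z-ρ) + G, with principal branches. The cut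
of log(z-ρ) runs horizontally to the left of ρ, so it misses `Re z > 1` and the heights 0 and T, at
which there are no zeros. The radius T + 3 leaves room for the contour up to σ = 2. -/
theorem exists_log_E {T : ℝ} (hT : 0 < T) (hgen : ∀ s, E s = 0 → s.im ≠ T) :
    ∃ Λ : ℂ → ℂ, (∀ z : ℂ, ‖z - 1 / 2‖ < T + 3 → 1 < z.re ∨ z.im = 0 ∨ z.im = T →
        ContinuousAt Λ z ∧ Complex.exp (Λ z) = E z) ∧
      (Λ (1 / 2 + T * Complex.I)).im - (Λ (1 / 2)).im = Real.pi * zeroCount T := by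
  have hfin := finite_zeros_E (isCompact_closedBall (1 / 2 : ℂ) (T + 3))
  set S : Finset ℂ := hfin.toFinset with hSdef
  have hSmem : ∀ ρ, ρ ∈ S ↔ ‖ρ - 1 / 2‖ ≤ T + 3 ∧ E ρ = 0 := fun ρ => by
    rw [hSdef, Set.Finite.mem_toFinset, Set.mem_ofPred_eq, Metric.mem_closedBall, dist_eq_norm]
  set n : ℂ → ℕ := analyticOrderNatAt E with hn
  have hSinv : ∀ ρ ∈ S, 1 - (starRingEnd ℂ) ρ ∈ S := by
    intro ρ hρ
    obtain ⟨h1, h2⟩ := (hSmem ρ).1 hρ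
    refine (hSmem _).2 ⟨?_, by rw [E_one_sub_conj, h2, map_zero]⟩
    have : 1 - (starRingEnd ℂ) ρ - 1 / 2 = -(starRingEnd ℂ) (ρ - 1 / 2) := by
      simp only [map_sub, map_div₀, map_one, map_ofNat]; ring
    rwa [this, norm_neg, Complex.norm_conj]
  have hninv : ∀ ρ ∈ S, n (1 - (starRingEnd ℂ) ρ) = n ρ := fun ρ _ =>
    analyticOrderNatAt_E_one_sub_conj ρ
  obtain ⟨g, hg, hEg, hgS⟩ := exists_eq_prod_mul analyticOnNhd_E S (Set.subset_univ _)
    (fun ρ _ => analyticOrderAt_E_ne_top ρ)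
  have hgd : Differentiable ℂ g := fun z => (hg z trivial).differentiableAt
  have hg0 : ∀ z ∈ Metric.ball (1 / 2 : ℂ) (T + 3), g z ≠ 0 := by
    intro z hz
    by_cases hzS : z ∈ S
    · exact hgS z hzS
    · intro h
      rw [Metric.mem_ball, dist_eq_norm] at hz
      exact hzS ((hSmem z).2 ⟨hz.le, by rw [hEg z, h, mul_zero]⟩)
  obtain ⟨G, hGd, hGexp⟩ := exists_log_of_differentiableOn_ball hgd.differentiableOn hg0
  have hSim0 : ∀ ρ ∈ S, ρ.im ≠ 0 := fun ρ hρ => im_ne_zero_of_E_eq_zero ((hSmem ρ).1 hρ).2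
  have hSimT : ∀ ρ ∈ S, ρ.im ≠ T := fun ρ hρ => hgen ρ ((hSmem ρ).1 hρ).2
  have hline : ∀ t ∈ Set.uIcc 0 T, (1 / 2 + t * Complex.I : ℂ) ∈ Metric.ball (1 / 2 : ℂ) (T + 3) := by
    intro t ht
    rw [Set.uIcc_of_le hT.le] at ht
    rw [Metric.mem_ball, dist_eq_norm, add_sub_cancel_left, norm_mul, Complex.norm_I, mul_one,
      Complex.norm_real, Real.norm_eq_abs, abs_of_nonneg ht.1]
    linarith [ht.2]
  refine ⟨fun z => ∑ ρ ∈ S, (n ρ : ℂ) * Complex.log (z - ρ) + G z, fun z hz hcase => ?_, ?_⟩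
  · have hzb : z ∈ Metric.ball (1 / 2 : ℂ) (T + 3) := by rwa [Metric.mem_ball, dist_eq_norm]
    have hslit : ∀ ρ ∈ S, z - ρ ∈ Complex.slitPlane := by
      intro ρ hρ
      rw [Complex.mem_slitPlane_iff, Complex.sub_re, Complex.sub_im]
      rcases hcase with h | h | h
      · left
        linarith [(re_mem_Icc_of_E_eq_zero ((hSmem ρ).1 hρ).2).2]
      · right; rw [h]; simpa using hSim0 ρ hρ
      · right; rw [h]; exact sub_ne_zero.2 (hSimT ρ hρ).symm
    constructor
    · refine ContinuousAt.add ?_ (hGd.differentiableAt (Metric.isOpen_ball.mem_nhds hzb)).continuousAt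
      refine tendsto_finsetSum _ fun ρ hρ => ?_
      exact continuousAt_const.mul ((continuousAt_id.sub continuousAt_const).clog (hslit ρ hρ))
    · rw [Complex.exp_add, hGexp z hzb, hEg z, Complex.exp_sum]
      congr 1
      refine Finset.prod_congr rfl fun ρ hρ => ?_
      rw [Complex.exp_nat_mul, Complex.exp_log (Complex.slitPlane_ne_zero (hslit ρ hρ))]
  · have hGim : (G (1 / 2 + T * Complex.I)).im = (G (1 / 2)).im := by
      have hhalf : (1 / 2 : ℂ) = 1 / 2 + ((0 : ℝ) : ℂ) * Complex.I := by simp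
      have h0 : (1 / 2 : ℂ) ∈ Metric.ball (1 / 2 : ℂ) (T + 3) :=
        Metric.mem_ball_self (by linarith)
      have hconjg := conj_eq_neg_one_pow_mul hSinv hninv hgd.continuous hEg
      have key := im_eq_of_exp_im_eq_zero
        (u := fun t : ℝ => G (1 / 2 + t * Complex.I) - G (1 / 2)) (a := 0) (b := T) ?_ ?_
      · simp only [Complex.sub_im, Complex.ofReal_zero, zero_mul, add_zero, sub_self, Complex.zero_im] at key
        linarith
      · refine ContinuousOn.sub (hGd.continuousOn.comp ?_ hline) continuousOn_const
        fun_prop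
      -- The sign (-1)^N cancels in the quotient g(1/2+it)/g(1/2), which is therefore real.
      · intro t ht
        have hconj0 := hconjg 0
        rw [← hhalf] at hconj0
        rw [Complex.exp_sub, hGexp _ (hline t ht), hGexp _ h0, ← Complex.conj_eq_iff_im, map_div₀,
          hconjg t, hconj0, mul_div_mul_left _ _ (pow_ne_zero _ (by norm_num))]
    have him : ∀ t : ℝ, (∑ ρ ∈ S, (n ρ : ℂ) * Complex.log (1 / 2 + t * Complex.I - ρ)).im =
        ∑ ρ ∈ S, (n ρ : ℝ) * (1 / 2 + t * Complex.I - ρ).arg := by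
      intro t
      rw [Complex.im_sum]
      refine Finset.sum_congr rfl fun ρ _ => ?_
      rw [Complex.mul_im, Complex.log_im]
      simp
    have hcount : (zeroCount T : ℝ) = ∑ ρ ∈ S, (n ρ : ℝ) * (if 0 < ρ.im ∧ ρ.im < T then 1 else 0) := by
      have hset : zerosUpTo T = ((S.filter fun ρ => 0 < ρ.im ∧ ρ.im < T : Finset ℂ) : Set ℂ) := by
        ext s
        rw [Finset.coe_filter, Set.mem_ofPred_eq, hSmem]
        constructor
        · rintro ⟨hs, h0, h1, h2, h3⟩
          exact ⟨⟨by linarith [norm_sub_half_le h0 h1 h2], hs⟩,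
            lt_of_le_of_ne h2 (im_ne_zero_of_E_eq_zero hs).symm, lt_of_le_of_ne h3 (hgen s hs)⟩
        · rintro ⟨⟨_, hs⟩, h2, h3⟩
          obtain ⟨h0, h1⟩ := re_mem_Icc_of_E_eq_zero hs
          exact ⟨hs, h0, h1, h2.le, h3.le⟩
      rw [zeroCount, hset, finsum_mem_coe_finset, Nat.cast_sum, Finset.sum_filter]
      refine Finset.sum_congr rfl fun ρ _ => ?_
      split_ifs <;> simp [hn]
    have h1 := two_mul_sum_arg hSinv hninv hSimT
    have h2 := two_mul_sum_arg hSinv hninv hSim0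
    have h3 := him T
    have h4 := him 0
    simp only [Complex.ofReal_zero, zero_mul, add_zero] at h2 h4
    simp only [Complex.add_im]
    rw [hGim, h3, h4, hcount]
    -- Zeros below the real axis or above T contribute equally at both ends; each one in between
    -- changes sign and contributes 2π.
    have h5 : ∑ ρ ∈ S, (n ρ : ℝ) * (if ρ.im < T then Real.pi else -Real.pi) -
        ∑ ρ ∈ S, (n ρ : ℝ) * (if ρ.im < 0 then Real.pi else -Real.pi) =
        2 * (Real.pi * ∑ ρ ∈ S, (n ρ : ℝ) * (if 0 < ρ.im ∧ ρ.im < T then 1 else 0)) := by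
      rw [← Finset.sum_sub_distrib, Finset.mul_sum, Finset.mul_sum]
      refine Finset.sum_congr rfl fun ρ hρ => ?_
      have hne := hSim0 ρ hρ
      rcases lt_or_gt_of_ne hne with hneg | hpos
      · rw [if_pos (hneg.trans hT), if_pos hneg, if_neg (fun h => by linarith [h.1])]
        ring
      · rw [if_neg (not_lt.2 hpos.le)]
        by_cases hlt : ρ.im < T
        · rw [if_pos hlt, if_pos ⟨hpos, hlt⟩]; ring
        · rw [if_neg hlt, if_neg (fun h => hlt h.2)]; ring
    linarith

end EReversed

namespace EReversed

/-! ### The Dirichlet series part on the line `σ = 2` and its growth -/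

/-- The leading term 1 outweighs the tail, which is at most ζ(2) - 1. So ζ and L have positive real
part on σ = 2 and principal logarithms are continuous there. -/
lemma two_sub_le_re_LSeries {f : ℕ → ℂ} (h1 : f 1 = 1) (hb : ∀ n, n ≠ 0 → ‖f n‖ ≤ 1) {s : ℂ}
    (hs : s.re = 2) : 2 - Real.pi ^ 2 / 6 ≤ (LSeries f s).re := by
  have hsum : Summable (LSeries.term f s) :=
    LSeriesSummable_of_bounded_of_one_lt_re hb (by rw [hs]; norm_num)
  have hsplit := hsum.sum_add_tsum_nat_add 2
  have hz := hasSum_zeta_two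
  have hzsplit := hz.summable.sum_add_tsum_nat_add 2
  rw [hz.tsum_eq] at hzsplit
  have hzs := ((summable_nat_add_iff 2).2 hz.summable).hasSum
  have htail : ‖∑' n : ℕ, LSeries.term f s (n + 2)‖ ≤ ∑' n : ℕ, 1 / ((n + 2 : ℕ) : ℝ) ^ 2 := by
    refine tsum_of_norm_bounded hzs fun n => ?_
    rw [LSeries.term_of_ne_zero (by lia), norm_div, Complex.norm_natCast_cpow_of_pos (by lia), hs]
    norm_cast
    exact div_le_div_of_nonneg_right (hb _ (by lia)) (by positivity)
  rw [LSeries, ← hsplit, Complex.add_re]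
  have h2 : ∑ i ∈ Finset.range 2, LSeries.term f s i = 1 := by
    rw [Finset.sum_range_succ, Finset.sum_range_one, LSeries.term_zero,
      LSeries.term_of_ne_zero one_ne_zero, h1]
    simp
  have h3 : ∑ i ∈ Finset.range 2, (1 : ℝ) / (i : ℝ) ^ 2 = 1 := by
    simp [Finset.sum_range_succ]
  rw [h3] at hzsplit
  rw [h2, Complex.one_re]
  have := (abs_le.1 (Complex.abs_re_le_norm (∑' n : ℕ, LSeries.term f s (n + 2)))).1
  linarith

lemma two_sub_pi_sq_div_six_pos : 0 < 2 - Real.pi ^ 2 / 6 := by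
  nlinarith [Real.pi_lt_d2, Real.pi_pos]

lemma two_sub_le_re_zeta {s : ℂ} (hs : s.re = 2) :
    2 - Real.pi ^ 2 / 6 ≤ (riemannZeta s).re := by
  rw [← LSeries_one_eq_riemannZeta (by rw [hs]; norm_num)]
  exact two_sub_le_re_LSeries rfl (fun n _ => by simp) hs

lemma two_sub_le_re_dirichletL {s : ℂ} (hs : s.re = 2) :
    2 - Real.pi ^ 2 / 6 ≤ (dirichletL s).re := by
  rw [dirichletL, DirichletCharacter.LFunction_eq_LSeries _ (by rw [hs]; norm_num)]
  exact two_sub_le_re_LSeries (by simp) (fun n _ => chi4.norm_le_one _) hs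

lemma half_le_re_one_sub_two_cpow {s : ℂ} (hs : s.re ≤ -1) : 1 / 2 ≤ (1 - (2 : ℂ) ^ s).re := by
  have h1 : ‖(2 : ℂ) ^ s‖ ≤ 1 / 2 := by
    rw [norm_two_cpow]
    calc (2 : ℝ) ^ s.re ≤ (2 : ℝ) ^ (-1 : ℝ) := Real.rpow_le_rpow_of_exponent_le one_le_two hs
      _ = 1 / 2 := by rw [Real.rpow_neg_one]; norm_num
  have := Complex.re_le_norm ((2 : ℂ) ^ s)
  rw [Complex.sub_re, Complex.one_re]
  linarith

lemma seriesPart_eq_of_re_eq_two {s : ℂ} (hs : s.re = 2) : seriesPart s =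
    (1 - (2 : ℂ) ^ (-s)) * (1 - (2 : ℂ) ^ (1 - s)) * riemannZeta s * dirichletL s := by
  have hs1 : s ≠ 1 := by rintro rfl; norm_num at hs
  rw [seriesPart, pairedSeries_two_one_two (by rw [hs]; norm_num) hs1,
    pairedSeries_four_one_three (by rw [hs]; norm_num)]
  ring

lemma norm_seriesPart_ge {s : ℂ} (hs : s.re = 2) :
    (1 / 2) * (1 / 2) * (2 - Real.pi ^ 2 / 6) * (2 - Real.pi ^ 2 / 6) ≤ ‖seriesPart s‖ := by
  have h0 := two_sub_pi_sq_div_six_pos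
  rw [seriesPart_eq_of_re_eq_two hs, norm_mul, norm_mul, norm_mul]
  have h1 := (half_le_re_one_sub_two_cpow (s := -s) (by simp [hs])).trans (Complex.re_le_norm _)
  have h2 := (half_le_re_one_sub_two_cpow (s := 1 - s) (by simp [hs]; norm_num)).trans
    (Complex.re_le_norm _)
  have h3 := (two_sub_le_re_zeta hs).trans (Complex.re_le_norm _)
  have h4 := (two_sub_le_re_dirichletL hs).trans (Complex.re_le_norm _)
  gcongr

/-- A bounded logarithm of the Dirichlet series part on the line `σ = 2`. -/
noncomputable def logSeriesPart (s : ℂ) : ℂ :=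
  Complex.log (1 - (2 : ℂ) ^ (-s)) + Complex.log (1 - (2 : ℂ) ^ (1 - s)) +
    Complex.log (riemannZeta s) + Complex.log (dirichletL s)

lemma abs_im_logSeriesPart_le (s : ℂ) : |(logSeriesPart s).im| ≤ 4 * Real.pi := by
  have h1 := abs_le.1 (abs_im_log_le (1 - (2 : ℂ) ^ (-s)))
  have h2 := abs_le.1 (abs_im_log_le (1 - (2 : ℂ) ^ (1 - s)))
  have h3 := abs_le.1 (abs_im_log_le (riemannZeta s))
  have h4 := abs_le.1 (abs_im_log_le (dirichletL s))
  simp only [logSeriesPart, Complex.add_im]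
  rw [abs_le]
  constructor <;> linarith [h1.1, h1.2, h2.1, h2.2, h3.1, h3.2, h4.1, h4.2]

lemma logSeriesPart_spec {s : ℂ} (hs : s.re = 2) :
    ContinuousAt logSeriesPart s ∧ Complex.exp (logSeriesPart s) = seriesPart s := by
  have hs1 : s ≠ 1 := by rintro rfl; norm_num at hs
  have h0 := two_sub_pi_sq_div_six_pos
  have h1 : 0 < (1 - (2 : ℂ) ^ (-s)).re := by
    linarith [half_le_re_one_sub_two_cpow (s := -s) (by simp [hs])]
  have h2 : 0 < (1 - (2 : ℂ) ^ (1 - s)).re := by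
    linarith [half_le_re_one_sub_two_cpow (s := 1 - s) (by simp [hs]; norm_num)]
  have h3 : 0 < (riemannZeta s).re := by linarith [two_sub_le_re_zeta hs]
  have h4 : 0 < (dirichletL s).re := by linarith [two_sub_le_re_dirichletL hs]
  have hslit : ∀ {z : ℂ}, 0 < z.re → z ∈ Complex.slitPlane := fun h =>
    Complex.mem_slitPlane_iff.2 (Or.inl h)
  constructor
  · have c1 : ContinuousAt (fun s : ℂ => 1 - (2 : ℂ) ^ (-s)) s :=
      continuousAt_const.sub
        (differentiable_two_cpow.continuous.comp continuous_neg).continuousAt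
    have c2 : ContinuousAt (fun s : ℂ => 1 - (2 : ℂ) ^ (1 - s)) s :=
      (differentiable_two_cpow_one_sub.const_sub 1).continuous.continuousAt
    have c3 : ContinuousAt riemannZeta s := (differentiableAt_riemannZeta hs1).continuousAt
    have c4 : ContinuousAt dirichletL s :=
      (DirichletCharacter.differentiable_LFunction chi4_ne_one).continuous.continuousAt
    exact (((c1.clog (hslit h1)).add (c2.clog (hslit h2))).add (c3.clog (hslit h3))).add
      (c4.clog (hslit h4))
  · rw [logSeriesPart, Complex.exp_add, Complex.exp_add, Complex.exp_add,
      Complex.exp_log (Complex.slitPlane_ne_zero (hslit h1)),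
      Complex.exp_log (Complex.slitPlane_ne_zero (hslit h2)),
      Complex.exp_log (Complex.slitPlane_ne_zero (hslit h3)),
      Complex.exp_log (Complex.slitPlane_ne_zero (hslit h4)), seriesPart_eq_of_re_eq_two hs]

lemma differentiableAt_seriesPart {s : ℂ} (hs : 0 < s.re) : DifferentiableAt ℂ seriesPart s :=
  ((((differentiable_two_cpow.comp differentiable_neg).const_sub 1) s).mul
    (differentiableAt_pairedSeries le_rfl one_le_two one_le_two hs)).mul
    (differentiableAt_pairedSeries le_rfl (by norm_num) (by norm_num) hs)

lemma analyticAt_seriesPart {s : ℂ} (hs : 0 < s.re) : AnalyticAt ℂ seriesPart s :=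
  DifferentiableOn.analyticAt
    (fun _ hz => (differentiableAt_seriesPart hz).differentiableWithinAt)
    (isOpen_re_pos.mem_nhds hs)

lemma exists_norm_seriesPart_le :
    ∃ C : ℝ, 0 < C ∧ ∀ s : ℂ, 1 / 4 ≤ s.re → ‖seriesPart s‖ ≤ C * ‖s‖ ^ 2 := by
  obtain ⟨C₁, h1⟩ := norm_pairedSeries_le (m := 2) (a := 1) (b := 2) le_rfl one_le_two one_le_two
    (σ := 1 / 4) (by norm_num)
  obtain ⟨C₂, h2⟩ := norm_pairedSeries_le (m := 4) (a := 1) (b := 3) le_rfl (by norm_num)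
    (by norm_num) (σ := 1 / 4) (by norm_num)
  refine ⟨2 * |C₁| * |C₂| + 1, by positivity, fun s hs => ?_⟩
  have h3 : ‖1 - (2 : ℂ) ^ (-s)‖ ≤ 2 := by
    refine (norm_sub_le _ _).trans ?_
    rw [norm_one, norm_two_cpow]
    have : (2 : ℝ) ^ (-s).re ≤ 1 := Real.rpow_le_one_of_one_le_of_nonpos one_le_two (by
      simp; linarith)
    linarith
  have h4 : ‖pairedSeries 2 1 2 s‖ ≤ |C₁| * ‖s‖ := (h1 s hs).trans (by
    gcongr; exact le_abs_self _)
  have h5 : ‖pairedSeries 4 1 3 s‖ ≤ |C₂| * ‖s‖ := (h2 s hs).trans (by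
    gcongr; exact le_abs_self _)
  rw [seriesPart, norm_mul, norm_mul]
  calc _ ≤ 2 * (|C₁| * ‖s‖) * (|C₂| * ‖s‖) := by gcongr
    _ = 2 * |C₁| * |C₂| * ‖s‖ ^ 2 := by ring
    _ ≤ _ := by gcongr; linarith

/-- The logarithm of the archimedean part. -/
noncomputable def logGammaPart (s : ℂ) : ℂ :=
  logGamma s + s * ((Real.log (2 / Real.pi) : ℝ) : ℂ) + Real.pi * Complex.I

lemma continuousAt_logGammaPart {s : ℂ} (hs : 0 < s.re) : ContinuousAt logGammaPart s :=
  ((continuousAt_logGamma hs).add (continuousAt_id.mul continuousAt_const)).add continuousAt_const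

lemma exp_logGammaPart {s : ℂ} (hs : 0 < s.re) : Complex.exp (logGammaPart s) = gammaPart s := by
  have h2 : (2 : ℂ) ^ s / (Real.pi : ℂ) ^ s =
      Complex.exp (s * ((Real.log (2 / Real.pi) : ℝ) : ℂ)) := by
    rw [Real.log_div two_ne_zero Real.pi_ne_zero,
      Complex.cpow_def_of_ne_zero (Complex.ofReal_ne_zero.2 Real.pi_ne_zero),
      Complex.cpow_def_of_ne_zero two_ne_zero, ← Complex.exp_sub, Complex.ofReal_sub,
      Complex.ofReal_log zero_le_two, Complex.ofReal_log Real.pi_pos.le, Complex.ofReal_ofNat]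
    congr 1
    ring
  rw [logGammaPart, Complex.exp_add, Complex.exp_add, exp_logGamma hs, Complex.exp_pi_mul_I,
    gammaPart, h2]
  ring

lemma abs_im_logGammaPart_sub_le {T : ℝ} (hT : 1 ≤ T) :
    |(logGammaPart (1 / 2 + T * Complex.I)).im -
      (T * Real.log T - T + T * Real.log (2 / Real.pi))| ≤ 7 := by
  have h1 := abs_le.1 (abs_im_logGamma_sub_le hT)
  have h2 : (logGammaPart (1 / 2 + T * Complex.I)).im =
      (logGamma (1 / 2 + T * Complex.I)).im + T * Real.log (2 / Real.pi) + Real.pi := by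
    simp only [logGammaPart, Complex.add_im, Complex.im_mul_ofReal]
    simp
  have hpi := Real.pi_lt_d2
  have hpi0 := Real.pi_pos
  rw [h2, abs_le]
  constructor <;> linarith [h1.1, h1.2]

/-! ### Counting the zeros -/

lemma exists_log_seriesPart : ∃ C : ℝ, ∀ T : ℝ, 2 ≤ T → (∀ s, E s = 0 → s.im ≠ T) →
    ∃ u : ℝ → ℂ, ContinuousOn u (Set.uIcc (1 / 2) 2) ∧
      (∀ x ∈ Set.uIcc (1 / 2 : ℝ) 2, Complex.exp (u x) = seriesPart (x + T * Complex.I)) ∧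
      |(u (1 / 2)).im - (u 2).im| ≤ C * (Real.log T + 1) := by
  -- Around 2 + iT the radius 3/2 just reaches σ = 1/2, and the disc of radius 7/4 stays in σ ≥ 1/4,
  -- where the quadratic growth bound holds.
  obtain ⟨C, hC⟩ := exists_log_on_radius (r := 3 / 2) (r₁ := 13 / 8) (R := 7 / 4) (by norm_num)
    (by norm_num) (by norm_num)
  obtain ⟨A, hA0, hA⟩ := exists_norm_seriesPart_le
  set δ : ℝ := (1 / 2) * (1 / 2) * (2 - Real.pi ^ 2 / 6) * (2 - Real.pi ^ 2 / 6) with hδ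
  have hδ0 : 0 < δ := by
    have := two_sub_pi_sq_div_six_pos
    positivity
  refine ⟨|C| * (|Real.log (9 * A / δ)| + 2), fun T hT hgen => ?_⟩
  have hT0 : 0 < T := by linarith
  set c : ℂ := 2 + T * Complex.I with hc
  have hre : ∀ z ∈ Metric.closedBall (0 : ℂ) (7 / 4), 1 / 4 ≤ (z + c).re := by
    intro z hz
    have h1 := (abs_le.1 (Complex.abs_re_le_norm z)).1
    have h2 : ‖z‖ ≤ 7 / 4 := by simpa using hz
    have h3 : (z + c).re = z.re + 2 := by simp [hc]
    rw [h3]; linarith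
  have hcnorm : ‖c‖ ≤ 2 + T := by
    refine (norm_add_le _ _).trans ?_
    rw [norm_mul, Complex.norm_I, Complex.norm_real, Real.norm_eq_abs, abs_of_pos hT0]
    simp
  have hc_re : ∀ z ∈ Metric.closedBall (0 : ℂ) (7 / 4), 0 < (z + c).re := fun z hz => by
    linarith [hre z hz]
  have han : AnalyticOnNhd ℂ (fun z => seriesPart (z + c)) (Metric.closedBall 0 (7 / 4)) :=
    fun z hz => (analyticAt_seriesPart (hc_re z hz)).comp_of_eq
      (analyticAt_id.add analyticAt_const) rfl
  have hbd : ∀ z ∈ Metric.closedBall (0 : ℂ) (7 / 4), ‖seriesPart (z + c)‖ ≤ A * (3 * T) ^ 2 := by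
    intro z hz
    refine (hA _ (hre z hz)).trans ?_
    have h2 : ‖z‖ ≤ 7 / 4 := by simpa using hz
    have h3 : ‖z + c‖ ≤ 3 * T := (norm_add_le _ _).trans (by linarith)
    gcongr
  have hnz : ∀ z ∈ Metric.closedBall (0 : ℂ) (7 / 4), z.im = 0 → seriesPart (z + c) ≠ 0 := by
    intro z hz him h
    refine hgen (z + c) (by rw [E_eq_mul (hc_re z hz), h, mul_zero]) ?_
    simp [hc, him]
  obtain ⟨u, hu, huexp, huim⟩ := hC (fun z => seriesPart (z + c)) (A * (3 * T) ^ 2) han hbd hnz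
  refine ⟨fun x => u (x - 2), ?_, fun x hx => ?_, ?_⟩
  · refine hu.comp (by fun_prop) fun x hx => ?_
    rw [Set.uIcc_of_le (by norm_num)] at hx
    exact ⟨by linarith [hx.1], by linarith [hx.2]⟩
  · rw [Set.uIcc_of_le (by norm_num)] at hx
    rw [huexp (x - 2) ⟨by linarith [hx.1], by linarith [hx.2]⟩, hc]
    congr 1
    push_cast
    ring
  · norm_num at huim ⊢
    refine huim.trans ?_
    have hc2 : δ ≤ ‖seriesPart c‖ := norm_seriesPart_ge (by simp [hc])
    have hlogT : 0 ≤ Real.log T := Real.log_nonneg (by linarith)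
    have hcpos : 0 < ‖seriesPart c‖ := hδ0.trans_le hc2
    have hlog1 : Real.log (A * (3 * T) ^ 2 / ‖seriesPart c‖) ≤
        Real.log (9 * A / δ) + 2 * Real.log T := by
      have h9 : 9 * A / δ * T ^ 2 = A * (3 * T) ^ 2 / δ := by ring
      have : Real.log (9 * A / δ) + 2 * Real.log T = Real.log (A * (3 * T) ^ 2 / δ) := by
        rw [← h9, Real.log_mul (by positivity) (by positivity), Real.log_pow]
        push_cast; ring
      rw [this]
      exact Real.log_le_log (by positivity) (by gcongr)
    have hlog0 : 0 ≤ Real.log (A * (3 * T) ^ 2 / ‖seriesPart c‖) := by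
      refine Real.log_nonneg ((one_le_div hcpos).2 ((hA c (by simp [hc]; norm_num)).trans ?_))
      gcongr
      linarith
    have habs := le_abs_self (Real.log (9 * A / δ))
    have habs0 := abs_nonneg (Real.log (9 * A / δ))
    calc C * (Real.log (A * (3 * T) ^ 2 / ‖seriesPart c‖) + 1)
        ≤ |C| * (Real.log (A * (3 * T) ^ 2 / ‖seriesPart c‖) + 1) := by
          gcongr; exact le_abs_self _
      _ ≤ |C| * ((|Real.log (9 * A / δ)| + 2) * (Real.log T + 1)) := by
          gcongr
          nlinarith [mul_nonneg habs0 hlogT]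
      _ = _ := by ring

/-- The main term of the counting function. -/
noncomputable def mainTerm (T : ℝ) : ℝ := T * Real.log T - T + T * Real.log (2 / Real.pi)

/-- Chaining the three sides cancels the argument of the Gamma part at 2 + iT; only its values at
1/2 + iT and 2 remain. The 8π bounds the two end values of `logSeriesPart`. -/
lemma exists_abs_count_sub_le_of_generic : ∃ C : ℝ, ∀ T : ℝ, 2 ≤ T →
    (∀ s, E s = 0 → s.im ≠ T) →
      |Real.pi * zeroCount T - mainTerm T| ≤ C * (Real.log T + 1) := by
  obtain ⟨C, hC⟩ := exists_log_seriesPart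
  refine ⟨C + (7 + |(logGammaPart 2).im| + 8 * Real.pi), fun T hT hgen => ?_⟩
  have hT0 : 0 < T := by linarith
  obtain ⟨Λ, hΛ, hcount⟩ := exists_log_E hT0 hgen
  obtain ⟨u, hu, huexp, huim⟩ := hC T hT hgen
  have hseg : ∀ x ∈ Set.uIcc (1 / 2 : ℝ) 2, 1 / 2 ≤ x ∧ x ≤ 2 := fun x hx => by
    rwa [Set.uIcc_of_le (by norm_num)] at hx
  have hline : ∀ t ∈ Set.uIcc 0 T, 0 ≤ t ∧ t ≤ T := fun t ht => by
    rwa [Set.uIcc_of_le hT0.le] at ht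
  have hnorm : ∀ x t : ℝ, 1 / 2 ≤ x → x ≤ 2 → 0 ≤ t → t ≤ T →
      ‖(x + t * Complex.I : ℂ) - 1 / 2‖ < T + 3 := by
    intro x t h1 h2 h3 h4
    refine (Complex.norm_le_abs_re_add_abs_im _).trans_lt ?_
    have h5 : ((x + t * Complex.I : ℂ) - 1 / 2).re = x - 1 / 2 := by simp
    have h6 : ((x + t * Complex.I : ℂ) - 1 / 2).im = t := by simp
    rw [h5, h6, abs_of_nonneg h3, abs_of_nonneg (by linarith)]
    linarith
  have hbottom : (Λ (1 / 2)).im = (Λ 2).im := by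
    have hx : ∀ x ∈ Set.uIcc (1 / 2 : ℝ) 2,
        ContinuousAt Λ (x : ℂ) ∧ Complex.exp (Λ x) = E x := fun x hx => by
      have := hnorm x 0 (hseg x hx).1 (hseg x hx).2 le_rfl hT0.le
      refine hΛ x (by simpa using this) (Or.inr (Or.inl (by simp)))
    have key := im_eq_of_exp_im_eq_zero (u := fun x : ℝ => Λ x) (a := 1 / 2) (b := 2)
      (fun x hx' => ((hx x hx').1.comp
        Complex.continuous_ofReal.continuousAt).continuousWithinAt) (fun x hx' => by
        rw [(hx x hx').2, ← Complex.conj_eq_iff_im, ← E_conj, Complex.conj_ofReal])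
    simpa using key
  have hright : (Λ 2 - logGammaPart 2 - logSeriesPart 2).im =
      (Λ (2 + T * Complex.I) - logGammaPart (2 + T * Complex.I) -
        logSeriesPart (2 + T * Complex.I)).im := by
    have hcont : Continuous fun t : ℝ => (2 + t * Complex.I : ℂ) := by fun_prop
    have hre : ∀ t : ℝ, (2 + t * Complex.I : ℂ).re = 2 := fun t => by simp
    have hpos : ∀ t : ℝ, 0 < (2 + t * Complex.I : ℂ).re := fun t => by rw [hre t]; norm_num
    have hx : ∀ t ∈ Set.uIcc 0 T, ContinuousAt Λ (2 + t * Complex.I) ∧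
        Complex.exp (Λ (2 + t * Complex.I)) = E (2 + t * Complex.I) := fun t ht => by
      have := hnorm 2 t (by norm_num) le_rfl (hline t ht).1 (hline t ht).2
      exact hΛ _ (by simpa using this) (Or.inl (by rw [hre t]; norm_num))
    have key := im_eq_of_exp_im_eq_zero (a := 0) (b := T)
      (u := fun t : ℝ => Λ (2 + t * Complex.I) - logGammaPart (2 + t * Complex.I) -
        logSeriesPart (2 + t * Complex.I))
      (fun t ht => (ContinuousAt.comp (f := fun t : ℝ => (2 + t * Complex.I : ℂ))
        (((hx t ht).1.sub (continuousAt_logGammaPart (hpos t))).sub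
          (logSeriesPart_spec (hre t)).1) hcont.continuousAt).continuousWithinAt)
      (fun t ht => by
        have h1 : seriesPart (2 + t * Complex.I) ≠ 0 :=
          seriesPart_ne_zero_of_one_lt_re (by rw [hre t]; norm_num)
        rw [Complex.exp_sub, Complex.exp_sub, (hx t ht).2, exp_logGammaPart (hpos t),
          (logSeriesPart_spec (hre t)).2, E_eq_mul (hpos t),
          mul_div_cancel_left₀ _ (gammaPart_ne_zero (hpos t)), div_self h1, Complex.one_im])
    simpa using key
  have htop : (Λ (1 / 2 + T * Complex.I) - logGammaPart (1 / 2 + T * Complex.I) - u (1 / 2)).im =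
      (Λ (2 + T * Complex.I) - logGammaPart (2 + T * Complex.I) - u 2).im := by
    have hcont : Continuous fun x : ℝ => (x + T * Complex.I : ℂ) := by fun_prop
    have hre : ∀ x ∈ Set.uIcc (1 / 2 : ℝ) 2, 0 < (x + T * Complex.I : ℂ).re := fun x hx => by
      have := (hseg x hx).1
      simp
      linarith
    have hx : ∀ x ∈ Set.uIcc (1 / 2 : ℝ) 2, ContinuousAt Λ (x + T * Complex.I) ∧
        Complex.exp (Λ (x + T * Complex.I)) = E (x + T * Complex.I) := fun x hx =>
      hΛ _ (hnorm x T (hseg x hx).1 (hseg x hx).2 hT0.le le_rfl) (Or.inr (Or.inr (by simp)))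
    have key := im_eq_of_exp_im_eq_zero (a := 1 / 2) (b := 2)
      (u := fun x : ℝ => Λ (x + T * Complex.I) - logGammaPart (x + T * Complex.I) - u x)
      (ContinuousOn.sub (fun x hx' => (ContinuousAt.comp
        (f := fun x : ℝ => (x + T * Complex.I : ℂ)) ((hx x hx').1.sub
          (continuousAt_logGammaPart (hre x hx'))) hcont.continuousAt).continuousWithinAt) hu)
      (fun x hx' => by
        have h1 : seriesPart (x + T * Complex.I) ≠ 0 := by
          rw [← huexp x hx']; exact Complex.exp_ne_zero _
        rw [Complex.exp_sub, Complex.exp_sub, (hx x hx').2, exp_logGammaPart (hre x hx'),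
          huexp x hx', E_eq_mul (hre x hx'),
          mul_div_cancel_left₀ _ (gammaPart_ne_zero (hre x hx')), div_self h1, Complex.one_im])
    simpa using key
  simp only [Complex.sub_im] at hright htop
  have hg := abs_le.1 (abs_im_logGammaPart_sub_le (T := T) (by linarith))
  have hs1 := abs_le.1 (abs_im_logSeriesPart_le 2)
  have hs2 := abs_le.1 (abs_im_logSeriesPart_le (2 + T * Complex.I))
  have hu' := abs_le.1 huim
  have hlogT : 0 ≤ Real.log T := Real.log_nonneg (by linarith)
  set B : ℝ := 7 + |(logGammaPart 2).im| + 8 * Real.pi with hB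
  have hBpos : 0 ≤ B := by have := Real.pi_pos; positivity
  have hBT : B ≤ B * (Real.log T + 1) := le_mul_of_one_le_right hBpos (by linarith)
  have h2 := abs_le.1 (le_refl |(logGammaPart 2).im|)
  rw [add_mul, ← hcount, mainTerm, abs_le]
  constructor <;> linarith [hg.1, hg.2, hs1.1, hs1.2, hs2.1, hs2.2, hu'.1, hu'.2, h2.1, h2.2]

/-- If T is the height of a zero, use T' slightly above T: finiteness makes T' generic with the same
zero count, and both sides of the bound are continuous as T' → T. -/
lemma exists_abs_count_sub_le : ∃ C : ℝ, ∀ T : ℝ, 2 ≤ T →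
    |Real.pi * zeroCount T - mainTerm T| ≤ C * (Real.log T + 1) := by
  obtain ⟨C, hC⟩ := exists_abs_count_sub_le_of_generic
  refine ⟨C, fun T hT => ?_⟩
  have hT0 : T ≠ 0 := by linarith
  have hev : ∀ᶠ T' in 𝓝[>] T, ∀ s ∈ zerosUpTo (T + 1), T < s.im → T' < s.im := by
    refine (Filter.eventually_all_finite (finite_zerosUpTo (T + 1))).2 fun s _ => ?_
    by_cases h : T < s.im
    · filter_upwards [nhdsWithin_le_nhds (Iio_mem_nhds h)] with T' hT' _ using hT'
    · exact Eventually.of_forall fun _ h' => absurd h' h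
  have hev2 : ∀ᶠ T' in 𝓝[>] T,
      |Real.pi * zeroCount T - mainTerm T'| ≤ C * (Real.log T' + 1) := by
    filter_upwards [hev, self_mem_nhdsWithin,
      nhdsWithin_le_nhds (Iio_mem_nhds (lt_add_one T))] with T' h1 h2 h3
    have h2' : T < T' := h2
    have h3' : T' < T + 1 := h3
    have hmem : ∀ s, E s = 0 → 0 ≤ s.im → s.im ≤ T' → s.im ≤ T := by
      intro s hs h0 h4
      by_contra! h5
      obtain ⟨h6, h7⟩ := re_mem_Icc_of_E_eq_zero hs
      exact absurd h4 (not_le.2 (h1 s ⟨hs, h6, h7, h0, by linarith⟩ h5))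
    have hset : zerosUpTo T' = zerosUpTo T := by
      ext s
      constructor
      · rintro ⟨hs, a, b, c, d⟩
        exact ⟨hs, a, b, c, hmem s hs c d⟩
      · rintro ⟨hs, a, b, c, d⟩
        exact ⟨hs, a, b, c, by linarith⟩
    have hcount : zeroCount T' = zeroCount T := by rw [zeroCount, zeroCount, hset]
    rw [← hcount]
    refine hC T' (by linarith) fun s hs h => ?_
    have := hmem s hs (by linarith) h.le
    linarith
  have hlog : Tendsto Real.log (𝓝[>] T) (𝓝 (Real.log T)) :=
    (Real.continuousAt_log hT0).tendsto.mono_left nhdsWithin_le_nhds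
  have hid : Tendsto (fun x : ℝ => x) (𝓝[>] T) (𝓝 T) := tendsto_id.mono_left nhdsWithin_le_nhds
  have hmain : Tendsto mainTerm (𝓝[>] T) (𝓝 (mainTerm T)) :=
    ((hid.mul hlog).sub hid).add (hid.mul_const _)
  exact le_of_tendsto_of_tendsto (hmain.const_sub _).abs ((hlog.add_const 1).const_mul C) hev2

lemma isBigO_zeroCount_sub :
    (fun T : ℝ => (zeroCount T : ℝ) -
        T / Real.pi * Real.log (2 * T / (Real.pi * Real.exp 1)))
      =O[atTop] fun T : ℝ => Real.log T := by
  obtain ⟨C, hC⟩ := exists_abs_count_sub_le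
  -- The factor 2 absorbs the constant: log T + 1 ≤ 2 log T for T ≥ e.
  refine IsBigO.of_bound (2 * |C| / Real.pi) ?_
  filter_upwards [eventually_ge_atTop (Real.exp 1), eventually_ge_atTop 2] with T hTe hT
  have hT0 : 0 < T := by linarith
  have hlog : 1 ≤ Real.log T := (Real.le_log_iff_exp_le hT0).2 hTe
  have hpi := Real.pi_pos
  have h1 : (zeroCount T : ℝ) - T / Real.pi * Real.log (2 * T / (Real.pi * Real.exp 1)) =
      (Real.pi * zeroCount T - mainTerm T) / Real.pi := by
    have h2 : Real.log (2 * T / (Real.pi * Real.exp 1)) =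
        Real.log T - 1 + Real.log (2 / Real.pi) := by
      rw [Real.log_div (by positivity) (by positivity), Real.log_mul two_ne_zero hT0.ne',
        Real.log_mul hpi.ne' (Real.exp_pos 1).ne', Real.log_exp,
        Real.log_div two_ne_zero hpi.ne']
      ring
    rw [h2, mainTerm]
    field_simp
  rw [h1, Real.norm_eq_abs, Real.norm_eq_abs, abs_div, abs_of_pos hpi,
    abs_of_pos (by linarith : 0 < Real.log T), div_le_iff₀ hpi]
  calc |Real.pi * zeroCount T - mainTerm T| ≤ C * (Real.log T + 1) := hC T hT
    _ ≤ |C| * (Real.log T + 1) := by gcongr; exact le_abs_self _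
    _ ≤ |C| * (2 * Real.log T) := by gcongr; linarith
    _ = 2 * |C| / Real.pi * Real.log T * Real.pi := by field_simp

end EReversed

theorem mainTheorem2 :
    -- `Э` is an entire function
    Differentiable ℂ EReversed.E ∧
    -- (i) the zeros lie in the closed strip, symmetrically about `t = 0` and about `σ = 1/2`
    ((∀ s : ℂ, EReversed.E s = 0 → 0 ≤ s.re ∧ s.re ≤ 1) ∧
      (∀ s : ℂ, EReversed.E s = 0 ↔ EReversed.E ((starRingEnd ℂ) s) = 0) ∧
      (∀ s : ℂ, EReversed.E s = 0 ↔ EReversed.E (1 - (starRingEnd ℂ) s) = 0)) ∧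
    -- (ii) description of the zeros; there are none on the real axis
    ((∀ s : ℂ, EReversed.E s = 0 ↔
        (s.im ≠ 0 ∧ EReversed.hFactor s = 0) ∨
          EReversed.IsNontrivialZetaZero s ∨ EReversed.IsNontrivialLZero s) ∧
      (∀ x : ℝ, EReversed.E (x : ℂ) ≠ 0)) ∧
    -- (iii) the number of zeros up to height `T`; the count is over finitely many points
    ((∀ T : ℝ, (EReversed.zerosUpTo T).Finite) ∧
      (fun T : ℝ => (EReversed.zeroCount T : ℝ) -
          T / Real.pi * Real.log (2 * T / (Real.pi * Real.exp 1)))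
        =O[atTop] fun T : ℝ => Real.log T) := by
  refine ⟨EReversed.differentiable_E, ⟨fun s => EReversed.re_mem_Icc_of_E_eq_zero, fun s => ?_,
    fun s => ?_⟩, ⟨EReversed.E_eq_zero_iff, EReversed.E_ofReal_ne_zero⟩,
    EReversed.finite_zerosUpTo, EReversed.isBigO_zeroCount_sub⟩
  · rw [EReversed.E_conj, map_eq_zero]
  · rw [EReversed.E_one_sub_conj, map_eq_zero]
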